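/- Throughout, $\|\cdot\|$ is the operator norm of an $n\times n$ real matrix acting on Euclidean space $\ell_2^n$. Let $B$ be a random $n\times n$ real symmetric matrix which is (almost surely) positive semidefinite and satisfies $\mathbb{E}B=I_n$. Assume that, for some $c>0$ and $\eta>0$, $B$ satisfies property (MSR) with parameters $c,\eta$: $$\mathbb{P}\big(\|PBP\|\geq t\big)\leq \frac{c}{t^{1+\eta}}\qquad\text{for every orthogonal projection } P \text{ of } \mathbb{R}^n \text{ and every } t>0 \text{ with } t\geq c\cdot\operatorname{rank}(P).$$ Set $$C_1=\max\Big\{(64c)^{1+\frac{2}{\eta}}\Big(1+\frac1\eta\Big)^{\frac{2}{\eta}},\; 64\,(4c)^{\frac1\eta}\Big(32+\frac{32}{\eta}\Big)^{1+\frac3\eta},\; 256\,(2c)^{\frac32+\frac2\eta}\Big(16+\frac{16}{\eta}\Big)^{\frac4\eta}\Big\}.$$ Then for every $\varepsilon\in(0,1)$, every integer $N\geq C_1\,n/\varepsilon^{2+\frac{2}{\eta}}$ and all independent copies $B_1,\dots,B_N$ of $B$, the random variable $\big\|\frac1N\sum_{i=1}^N B_i-I_n\big\|$ is integrable and $$\mathbb{E}\,\Big\|\frac1N\sum_{i=1}^N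 B_i-I_n\Big\|\leq\varepsilon .$$ -/

import Mathlib

open MeasureTheory ProbabilityTheory
open scoped Matrix.Norms.L2Operator

/-- The sigma-algebra on real matrices generated by the entries, i.e. the Borel sigma-algebra. -/
instance matrixMeasurableSpace (n : ℕ) : MeasurableSpace (Matrix (Fin n) (Fin n) ℝ) :=
  inferInstanceAs (MeasurableSpace (Fin n → Fin n → ℝ))

/-- The random matrix `B` has (entrywise) expectation `M`. -/
def HasMatrixExpectation {Ω : Type*} [MeasurableSpace Ω] {n : ℕ}
    (B : Ω → Matrix (Fin n) (Fin n) ℝ) (μ : Measure Ω) (M : Matrix (Fin n) (Fin n) ℝ) : Prop :=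
  ∀ i j, Integrable (fun ω => B ω i j) μ ∧ ∫ ω, B ω i j ∂μ = M i j

/-- The tail condition of the matrix strong regularity property (MSR) with parameters `c`, `η`:
for every orthogonal projection `P` of `ℝⁿ` and every real `t ≥ c * rank P`,
`ℙ (‖P B P‖ ≥ t) ≤ c / t ^ (1 + η)`, where `‖·‖` is the operator norm on Euclidean space.
The requirement `0 < t` only matters when `P = 0` and `t = 0`, where the right-hand side
is to be read as `+∞` (while Lean has `c / 0 = 0`). -/
def MSR {Ω : Type*} [MeasurableSpace Ω] {n : ℕ}
    (B : Ω → Matrix (Fin n) (Fin n) ℝ) (μ : Measure Ω) (c η : ℝ) : Prop :=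
  ∀ P : Matrix (Fin n) (Fin n) ℝ, IsStarProjection P →
    ∀ t : ℝ, 0 < t → c * (P.rank : ℝ) ≤ t →
      μ.real {ω | t ≤ ‖P * B ω * P‖} ≤ c / t ^ (1 + η)

/-- The constant `C₁ = C₁(c, η)`. -/
noncomputable def covConst (c η : ℝ) : ℝ :=
  max (max
    ((64 * c) ^ (1 + 2 / η) * (1 + 1 / η) ^ (2 / η))
    (64 * (4 * c) ^ (1 / η) * (32 + 32 / η) ^ (1 + 3 / η)))
    (256 * (2 * c) ^ (3 / 2 + 2 / η) * (16 + 16 / η) ^ (4 / η))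

/-! ### Loewner-order inequalities and the trace of the inverse under a perturbation. -/

section LoewnerOrder

open Matrix
open scoped MatrixOrder

variable {ι : Type*} [Fintype ι] [DecidableEq ι]

/-! The proof is a barrier argument in expectation. For a symmetric `A`, let `softMax φ A` be the
least `u` above the spectrum with `tr (u - A)⁻¹ ≤ φ`. It dominates the largest eigenvalue, is at
most `n / φ` at `A = 0`, and can be tracked as the independent summands are added one at a time,
conditionally on the previous ones.

Upper edge: `IsRegularLaw.integral_softMax_add_le` shows that adding one summand raises `softMax` by
at most `1 + O(ε)` on average. Lower edge: `IsRegularLaw.exists_decrease` shows that subtracting a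
summand lowers `softMax` by at least a bounded `δ` with mean at least `1 - O(ε)` and controlled
second moment. Heavy tails prevent a second-moment bound above, but none is needed there:
`norm_smul_sub_one_le` uses the upper edge linearly and only the lower edge through a positive part.
The latter is handled by the recursion for squares in `IsRegularLaw.integral_sq_max_le`.

A step is good when `b` is small relative to the resolvent (`b ≤ t M`) and a linear functional `tr
(V b)` is controlled. Property (MSR) speaks only of projections, while resolvents are weighted sums
of spectral projections. Tail bounds do not survive averaging, so they are replaced by bounds on the
mean excess `𝔼 (Z - a)₊`, which do by convexity (`HasExcessBound.of_le_average`); Markov's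
inequality then recovers a tail at the cost of the factor `D = 1 + 1/η`.

Parameters: `t = ε/32`, `φ = t / (a D)`, and a truncation level `a ≥ 2c` with `c a^(-η) D² ≤
ε²/256`, so `a` is of order `ε^(-2/η)`. The initial cost `n / (φ N)` is at most `ε/8` once `N ≥ 256
n a D / ε²`, which is where the exponent `2 + 2/η` comes from. -/

theorem Matrix.trace_mul_nonneg_of_nonneg {A B : Matrix ι ι ℝ} (hA : 0 ≤ A) (hB : 0 ≤ B) :
    0 ≤ (A * B).trace := by
  obtain ⟨C, rfl⟩ := CStarAlgebra.nonneg_iff_eq_star_mul_self.mp hA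
  rw [mul_assoc, Matrix.trace_mul_comm]
  exact (Matrix.nonneg_iff_posSemidef.mp (star_right_conjugate_nonneg hB C)).trace_nonneg

theorem Matrix.trace_le_trace {ι : Type*} [Fintype ι] {A B : Matrix ι ι ℝ} (h : A ≤ B) : A.trace ≤ B.trace := by
  have := (Matrix.le_iff.mp h).trace_nonneg
  rw [Matrix.trace_sub] at this
  linarith

theorem Matrix.trace_mul_le_trace_mul {A B C : Matrix ι ι ℝ} (h : A ≤ B) (hC : 0 ≤ C) :
    (A * C).trace ≤ (B * C).trace := by
  have := Matrix.trace_mul_nonneg_of_nonneg (sub_nonneg.mpr h) hC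
  rw [sub_mul, Matrix.trace_sub] at this
  linarith

/-- If `0 ≤ b ≤ s X` then `b X⁻¹ b ≤ s b`. -/
theorem Matrix.mul_inv_mul_le_smul {X Y b : Matrix ι ι ℝ} {s : ℝ} (hs : 0 < s)
    (hXY : X * Y = 1) (hY : IsSelfAdjoint Y) (hb : 0 ≤ b) (hbX : b ≤ s • X) :
    b * Y * b ≤ s • b := by
  have hbs : IsSelfAdjoint b := IsSelfAdjoint.of_nonneg hb
  -- Conjugating `b ≤ s X` by `Y b` bounds the cubic term in the expansion of `(s - b Y) b (s - Y b)
  -- ≥ 0`; what remains is `s (s b - b Y b) ≥ 0`.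
  have h1 : b * Y * b * (Y * b) ≤ s • (b * Y * b) := by
    have := star_left_conjugate_le_conjugate hbX (Y * b)
    rw [star_mul, hbs.star_eq, hY.star_eq] at this
    calc b * Y * b * (Y * b) ≤ b * Y * (s • X) * (Y * b) := this
      _ = s • (b * Y * (X * Y) * b) := by
          simp only [mul_smul_comm, smul_mul_assoc, mul_assoc]
      _ = s • (b * Y * b) := by rw [hXY, mul_one]
  have h2 := star_left_conjugate_nonneg hb (s • 1 - Y * b)
  rw [star_sub, star_mul, hbs.star_eq, hY.star_eq, star_smul, star_one, star_trivial] at h2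
  have h3 : (s • 1 - b * Y) * b * (s • 1 - Y * b)
      = s • (s • b) - (2 : ℝ) • s • (b * Y * b) + b * Y * b * (Y * b) := by
    simp only [sub_mul, mul_sub, smul_mul_assoc, mul_smul_comm, one_mul, mul_one, mul_assoc]
    module
  rw [h3] at h2
  have h4 : 0 ≤ s • (s • b - b * Y * b) := by
    calc (0 : Matrix ι ι ℝ) ≤ _ := h2
      _ ≤ s • (s • b) - (2 : ℝ) • s • (b * Y * b) + s • (b * Y * b) := by gcongr
      _ = _ := by module
  have h5 := smul_nonneg (inv_nonneg.mpr hs.le) h4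
  rw [smul_smul, inv_mul_cancel₀ hs.ne', one_smul] at h5
  exact sub_nonneg.mp h5

/-- If `b M⁻¹ b ≤ t b` then `b ≤ t M`. -/
theorem Matrix.le_smul_of_mul_inv_mul_le {M W b : Matrix ι ι ℝ} {t : ℝ} (ht : 0 < t)
    (hMW : M * W = 1) (hWM : W * M = 1) (hW : 0 ≤ W) (hM : IsSelfAdjoint M)
    (hb : IsSelfAdjoint b) (h : b * W * b ≤ t • b) : b ≤ t • M := by
  have h2 := star_left_conjugate_nonneg hW (t • M - b)
  rw [star_sub, hb.star_eq, star_smul, hM.star_eq, star_trivial] at h2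
  have h3 : (t • M - b) * W * (t • M - b) = t • t • M - (2 : ℝ) • t • b + b * W * b := by
    simp only [sub_mul, mul_sub, smul_mul_assoc, mul_smul_comm, hMW, one_mul]
    rw [mul_assoc b W M, hWM, mul_one]
    module
  rw [h3] at h2
  have h4 : 0 ≤ t • (t • M - b) := by
    calc (0 : Matrix ι ι ℝ) ≤ _ := h2
      _ ≤ t • t • M - (2 : ℝ) • t • b + t • b := by gcongr
      _ = _ := by module
  have h5 := smul_nonneg (inv_nonneg.mpr ht.le) h4
  rw [smul_smul, inv_mul_cancel₀ ht.ne', one_smul] at h5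
  exact sub_nonneg.mp h5

theorem Matrix.PosDef.mul_inv_self {M : Matrix ι ι ℝ} (hM : M.PosDef) : M * M⁻¹ = 1 :=
  Matrix.mul_nonsing_inv _ ((Matrix.isUnit_iff_isUnit_det _).mp hM.isUnit)

theorem Matrix.PosDef.inv_mul_self {M : Matrix ι ι ℝ} (hM : M.PosDef) : M⁻¹ * M = 1 :=
  Matrix.nonsing_inv_mul _ ((Matrix.isUnit_iff_isUnit_det _).mp hM.isUnit)

theorem Matrix.PosDef.of_le {ι : Type*} {M N : Matrix ι ι ℝ} (hM : M.PosDef) (h : M ≤ N) : N.PosDef := by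
  have := hM.add_posSemidef (Matrix.le_iff.mp h)
  rwa [add_sub_cancel] at this

/-- With `d = N - M`, the difference `M⁻¹ - N⁻¹` equals `N⁻¹ (d + d M⁻¹ d) N⁻¹`, which is visibly
nonnegative. -/
theorem Matrix.PosDef.inv_antitone {M N : Matrix ι ι ℝ} (hM : M.PosDef) (h : M ≤ N) :
    N⁻¹ ≤ M⁻¹ := by
  have hN := hM.of_le h
  have hd : 0 ≤ N - M := sub_nonneg.mpr h
  have hds : IsSelfAdjoint (N - M) := IsSelfAdjoint.of_nonneg hd
  have h1 : 0 ≤ (N - M) + (N - M) * M⁻¹ * (N - M) := by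
    refine add_nonneg hd ?_
    have := star_left_conjugate_nonneg hM.inv.posSemidef.nonneg (N - M)
    rwa [hds.star_eq] at this
  have h2 := star_left_conjugate_nonneg h1 N⁻¹
  rw [IsSelfAdjoint.star_eq (x := N⁻¹) hN.inv.isHermitian] at h2
  have h3 : N⁻¹ * ((N - M) + (N - M) * M⁻¹ * (N - M)) * N⁻¹ = M⁻¹ - N⁻¹ := by
    have e : (N - M) + (N - M) * M⁻¹ * (N - M) = N * M⁻¹ * N - N := by
      have e1 : M * M⁻¹ = 1 := hM.mul_inv_self
      have e2 : M⁻¹ * M = 1 := hM.inv_mul_self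
      simp only [sub_mul, mul_sub, e1, one_mul]
      rw [mul_assoc N M⁻¹ M, e2, mul_one]
      abel
    rw [e, mul_sub, sub_mul, mul_assoc N, ← mul_assoc N⁻¹ N, hN.inv_mul_self, one_mul, one_mul,
      mul_assoc, hN.mul_inv_self, mul_one]
  rw [h3] at h2
  exact sub_nonneg.mp h2

/-- A substitute for the Sherman–Morrison formula when `b` has arbitrary rank. With `X = M - b`, two
uses of the resolvent identity leave the remainder `M⁻¹ (b X⁻¹ b) M⁻¹`. Since `b ≤ (t/(1-t)) X`, the
middle factor is at most `(t/(1-t)) b`, and `1 + t/(1-t) = 1/(1-t)`. -/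
theorem Matrix.PosDef.trace_inv_sub_le {M b : Matrix ι ι ℝ} {t : ℝ} (hM : M.PosDef) (ht : 0 < t)
    (ht1 : t < 1) (hb : 0 ≤ b) (hbM : b ≤ t • M) :
    (M - b).PosDef ∧ ((M - b)⁻¹).trace ≤ (M⁻¹).trace + (M⁻¹ * b * M⁻¹).trace / (1 - t) := by
  have h1t : 0 < 1 - t := by linarith
  have hX : (M - b).PosDef := by
    refine (hM.smul h1t).of_le ?_
    calc (1 - t) • M = M - t • M := by module
      _ ≤ M - b := by gcongr
  refine ⟨hX, ?_⟩
  set X := M - b with hXdef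
  have hbX : b ≤ (t / (1 - t)) • X := by
    have h0 : 0 ≤ (1 - t)⁻¹ • (t • M - b) :=
      smul_nonneg (inv_nonneg.mpr h1t.le) (sub_nonneg.mpr hbM)
    refine sub_nonneg.mp (le_of_le_of_eq h0 ?_)
    have e : (1 - t)⁻¹ = t / (1 - t) + 1 := by field_simp; ring
    have e' : (t / (1 - t) + 1) * t = t / (1 - t) := by field_simp; ring
    rw [hXdef, e, smul_sub, smul_smul, e']
    module
  have hY := Matrix.mul_inv_mul_le_smul (div_pos ht h1t) hX.mul_inv_self hX.inv.isHermitian hb hbX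
  have hc := star_left_conjugate_le_conjugate hY M⁻¹
  rw [IsSelfAdjoint.star_eq (x := M⁻¹) hM.inv.isHermitian] at hc
  have e1 : X⁻¹ = M⁻¹ + M⁻¹ * b * X⁻¹ := by
    calc X⁻¹ = (M⁻¹ * M) * X⁻¹ := by rw [hM.inv_mul_self, one_mul]
      _ = M⁻¹ * ((X + b) * X⁻¹) := by rw [mul_assoc, hXdef, sub_add_cancel]
      _ = _ := by rw [add_mul, hX.mul_inv_self, mul_add, mul_one, mul_assoc]
  have e2 : X⁻¹ = M⁻¹ + X⁻¹ * b * M⁻¹ := by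
    calc X⁻¹ = X⁻¹ * (M * M⁻¹) := by rw [hM.mul_inv_self, mul_one]
      _ = X⁻¹ * (X + b) * M⁻¹ := by rw [mul_assoc, hXdef, sub_add_cancel]
      _ = _ := by rw [mul_add, hX.inv_mul_self, add_mul, one_mul]
  have e3 : X⁻¹ = M⁻¹ + M⁻¹ * b * M⁻¹ + M⁻¹ * (b * X⁻¹ * b) * M⁻¹ := by
    conv_lhs => rw [e1, e2]
    simp only [mul_add, mul_assoc, add_assoc]
  rw [e3, Matrix.trace_add, Matrix.trace_add]
  have h5 := Matrix.trace_le_trace hc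
  rw [mul_smul_comm, smul_mul_assoc, Matrix.trace_smul, smul_eq_mul] at h5
  have : (M⁻¹ * b * M⁻¹).trace / (1 - t)
      = (M⁻¹ * b * M⁻¹).trace + t / (1 - t) * (M⁻¹ * b * M⁻¹).trace := by
    field_simp; ring
  linarith

/-- The same expansion with `X = M + b`: now `b ≤ (t/(1+t)) X`, and `1 - t/(1+t) = 1/(1+t)`. -/
theorem Matrix.PosDef.trace_inv_add_le {M b : Matrix ι ι ℝ} {t : ℝ} (hM : M.PosDef) (ht : 0 < t)
    (hb : 0 ≤ b) (hbM : b ≤ t • M) :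
    ((M + b)⁻¹).trace ≤ (M⁻¹).trace - (M⁻¹ * b * M⁻¹).trace / (1 + t) := by
  have h1t : 0 < 1 + t := by linarith
  have hX : (M + b).PosDef := hM.add_posSemidef (Matrix.nonneg_iff_posSemidef.mp hb)
  set X := M + b with hXdef
  have hbX : b ≤ (t / (1 + t)) • X := by
    have h0 : 0 ≤ (1 + t)⁻¹ • (t • M - b) :=
      smul_nonneg (inv_nonneg.mpr h1t.le) (sub_nonneg.mpr hbM)
    refine sub_nonneg.mp (le_of_le_of_eq h0 ?_)
    have e : (1 + t)⁻¹ = 1 - t / (1 + t) := by field_simp; ring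
    have e' : (1 - t / (1 + t)) * t = t / (1 + t) := by field_simp; ring
    rw [hXdef, e, smul_sub, smul_smul, e']
    module
  have hY := Matrix.mul_inv_mul_le_smul (div_pos ht h1t) hX.mul_inv_self hX.inv.isHermitian hb hbX
  have hc := star_left_conjugate_le_conjugate hY M⁻¹
  rw [IsSelfAdjoint.star_eq (x := M⁻¹) hM.inv.isHermitian] at hc
  have e1 : X⁻¹ = M⁻¹ - M⁻¹ * b * X⁻¹ := by
    calc X⁻¹ = (M⁻¹ * M) * X⁻¹ := by rw [hM.inv_mul_self, one_mul]
      _ = M⁻¹ * ((X - b) * X⁻¹) := by rw [mul_assoc, hXdef, add_sub_cancel_right]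
      _ = _ := by rw [sub_mul, hX.mul_inv_self, mul_sub, mul_one, mul_assoc]
  have e2 : X⁻¹ = M⁻¹ - X⁻¹ * b * M⁻¹ := by
    calc X⁻¹ = X⁻¹ * (M * M⁻¹) := by rw [hM.mul_inv_self, mul_one]
      _ = X⁻¹ * (X - b) * M⁻¹ := by rw [mul_assoc, hXdef, add_sub_cancel_right]
      _ = _ := by rw [mul_sub, hX.inv_mul_self, sub_mul, one_mul]
  have e3 : X⁻¹ = M⁻¹ - M⁻¹ * b * M⁻¹ + M⁻¹ * (b * X⁻¹ * b) * M⁻¹ := by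
    conv_lhs => rw [e1, e2]
    simp only [mul_sub, mul_assoc]
    abel
  rw [e3, Matrix.trace_add, Matrix.trace_sub]
  have h5 := Matrix.trace_le_trace hc
  rw [mul_smul_comm, smul_mul_assoc, Matrix.trace_smul, smul_eq_mul] at h5
  have : (M⁻¹ * b * M⁻¹).trace / (1 + t)
      = (M⁻¹ * b * M⁻¹).trace - t / (1 + t) * (M⁻¹ * b * M⁻¹).trace := by
    field_simp; ring
  linarith

/-- The resolvent identity `X⁻¹ - (X + r)⁻¹ = r X⁻¹ (X + r)⁻¹`, with commuting factors. -/
theorem Matrix.PosDef.resolvent {X : Matrix ι ι ℝ} {r : ℝ} (hX : X.PosDef)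
    (hM : (X + r • (1 : Matrix ι ι ℝ)).PosDef) :
    X⁻¹ = (X + r • (1 : Matrix ι ι ℝ))⁻¹ + r • (X⁻¹ * (X + r • (1 : Matrix ι ι ℝ))⁻¹) ∧
    X⁻¹ = (X + r • (1 : Matrix ι ι ℝ))⁻¹ + r • ((X + r • (1 : Matrix ι ι ℝ))⁻¹ * X⁻¹) := by
  set M := X + r • (1 : Matrix ι ι ℝ) with hMdef
  constructor
  · calc X⁻¹ = X⁻¹ * (M * M⁻¹) := by rw [hM.mul_inv_self, mul_one]
      _ = X⁻¹ * ((X + r • (1 : Matrix ι ι ℝ)) * M⁻¹) := by rw [hMdef]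
      _ = _ := by
        rw [add_mul, mul_add, ← mul_assoc, hX.inv_mul_self, one_mul, smul_mul_assoc, one_mul,
          mul_smul_comm]
  · calc X⁻¹ = (M⁻¹ * M) * X⁻¹ := by rw [hM.inv_mul_self, one_mul]
      _ = M⁻¹ * ((X + r • (1 : Matrix ι ι ℝ)) * X⁻¹) := by rw [mul_assoc, hMdef]
      _ = _ := by
        rw [add_mul, hX.mul_inv_self, mul_add, mul_one, smul_mul_assoc, one_mul, mul_smul_comm]

end LoewnerOrder

/-! ### Spectral bounds, and deterministic conditions for moving a barrier. -/

section SpectralBounds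

open Matrix
open scoped MatrixOrder

variable {ι : Type*} [Fintype ι] [DecidableEq ι]

theorem Matrix.IsHermitian.exists_unitary_diagonal {A : Matrix ι ι ℝ} (hA : A.IsHermitian) :
    ∃ U ∈ unitary (Matrix ι ι ℝ), ∃ w : ι → ℝ, A = U * diagonal w * star U := by
  refine ⟨hA.eigenvectorUnitary, hA.eigenvectorUnitary.2, hA.eigenvalues, ?_⟩
  conv_lhs => rw [hA.spectral_theorem]
  simp [Unitary.conjStarAlgAut_apply]

theorem Matrix.smul_one_eq_conj {U : Matrix ι ι ℝ} (hU : U ∈ unitary (Matrix ι ι ℝ)) (c : ℝ) :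
    c • (1 : Matrix ι ι ℝ) = U * diagonal (fun _ => c) * star U := by
  have : diagonal (fun _ : ι => c) = c • (1 : Matrix ι ι ℝ) := by
    ext i j; by_cases h : i = j <;> simp [h]
  rw [this, mul_smul_comm, smul_mul_assoc, mul_one, Unitary.mul_star_self_of_mem hU]

theorem Matrix.conj_diagonal_le_iff {U : Matrix ι ι ℝ} (hU : U ∈ unitary (Matrix ι ι ℝ))
    {v w : ι → ℝ} :
    U * diagonal v * star U ≤ U * diagonal w * star U ↔ ∀ i, v i ≤ w i := by
  have key : diagonal v ≤ diagonal w ↔ ∀ i, v i ≤ w i := by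
    rw [Matrix.le_iff, Matrix.diagonal_sub, Matrix.posSemidef_diagonal_iff]
    simp [sub_nonneg]
  rw [← key]
  constructor
  · intro h
    have := star_left_conjugate_le_conjugate h U
    simpa [mul_assoc, Unitary.star_mul_self_of_mem hU, ← mul_assoc (star U) U] using this
  · intro h
    exact star_right_conjugate_le_conjugate h U

theorem Matrix.norm_conj_diagonal {U : Matrix ι ι ℝ} (hU : U ∈ unitary (Matrix ι ι ℝ))
    (w : ι → ℝ) : ‖U * diagonal w * star U‖ = ‖w‖ := by
  rw [CStarRing.norm_mul_mem_unitary _ (Unitary.star_mem hU), CStarRing.norm_mem_unitary_mul _ hU,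
    Matrix.l2_opNorm_diagonal]

theorem Matrix.IsHermitian.le_norm_smul_one {A : Matrix ι ι ℝ} (hA : A.IsHermitian) :
    A ≤ ‖A‖ • (1 : Matrix ι ι ℝ) := by
  obtain ⟨U, hU, w, h⟩ := hA.exists_unitary_diagonal
  rw [Matrix.smul_one_eq_conj hU, h, Matrix.norm_conj_diagonal hU, Matrix.conj_diagonal_le_iff hU]
  exact fun i => (le_abs_self _).trans (norm_le_pi_norm w i)

theorem Matrix.IsHermitian.norm_le_of_le {A : Matrix ι ι ℝ} {c : ℝ} (hA : A.IsHermitian)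
    (hc : 0 ≤ c) (h1 : A ≤ c • (1 : Matrix ι ι ℝ)) (h2 : -A ≤ c • (1 : Matrix ι ι ℝ)) :
    ‖A‖ ≤ c := by
  obtain ⟨U, hU, w, h⟩ := hA.exists_unitary_diagonal
  have hneg : -A = U * diagonal (fun i => - w i) * star U := by
    have : diagonal (fun i => - w i) = - diagonal w := by simp [Matrix.diagonal_neg]
    rw [this, mul_neg, neg_mul, h]
  rw [hneg, Matrix.smul_one_eq_conj hU, Matrix.conj_diagonal_le_iff hU] at h2
  rw [h, Matrix.smul_one_eq_conj hU, Matrix.conj_diagonal_le_iff hU] at h1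
  rw [h, Matrix.norm_conj_diagonal hU, pi_norm_le_iff_of_nonneg hc]
  exact fun i => abs_le.mpr ⟨by linarith [h2 i], h1 i⟩

theorem Matrix.le_trace_smul_one {W : Matrix ι ι ℝ} (hW : 0 ≤ W) :
    W ≤ W.trace • (1 : Matrix ι ι ℝ) := by
  obtain ⟨U, hU, w, h⟩ :=
    (Matrix.nonneg_iff_posSemidef.mp hW).isHermitian.exists_unitary_diagonal
  have h0 : ∀ i, 0 ≤ w i := by
    rw [← zero_smul ℝ (1 : Matrix ι ι ℝ), Matrix.smul_one_eq_conj hU, h,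
      Matrix.conj_diagonal_le_iff hU] at hW
    exact hW
  have ht : W.trace = ∑ i, w i := by
    rw [h, Matrix.trace_mul_comm, ← mul_assoc, Unitary.star_mul_self_of_mem hU, one_mul,
      Matrix.trace_diagonal]
  rw [ht, Matrix.smul_one_eq_conj hU]
  conv_lhs => rw [h]
  rw [Matrix.conj_diagonal_le_iff hU]
  exact fun i => Finset.single_le_sum (fun j _ => h0 j) (Finset.mem_univ i)

/-- A bound on the trace of `X⁻¹` bounds its largest eigenvalue. Taking `r = φ⁻¹`, `t = 1` shows
that a barrier stays at distance at least `φ⁻¹` from the spectrum. -/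
theorem Matrix.PosDef.smul_one_le {X : Matrix ι ι ℝ} {φ r t : ℝ} (hX : X.PosDef)
    (hφ : (X⁻¹).trace ≤ φ) (hr : 0 ≤ r) (ht : 0 < t) (h : r * φ ≤ t) :
    r • (1 : Matrix ι ι ℝ) ≤ t • X := by
  have hW : 0 ≤ X⁻¹ := hX.inv.posSemidef.nonneg
  have hone : (0 : Matrix ι ι ℝ) ≤ 1 := Matrix.PosSemidef.one.nonneg
  refine Matrix.le_smul_of_mul_inv_mul_le ht hX.mul_inv_self hX.inv_mul_self hW
    hX.isHermitian (IsSelfAdjoint.smul (IsSelfAdjoint.all r) (IsSelfAdjoint.one _)) ?_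
  calc r • (1 : Matrix ι ι ℝ) * X⁻¹ * r • (1 : Matrix ι ι ℝ) = (r * r) • X⁻¹ := by
        simp [smul_smul]
    _ ≤ (r * r) • ((X⁻¹).trace • (1 : Matrix ι ι ℝ)) := by
        gcongr; exact Matrix.le_trace_smul_one hW
    _ = (r * (r * (X⁻¹).trace)) • (1 : Matrix ι ι ℝ) := by rw [smul_smul, mul_assoc]
    _ ≤ (r * t) • (1 : Matrix ι ι ℝ) := by
        have : r * (X⁻¹).trace ≤ t := le_trans (by gcongr) h
        gcongr
    _ = t • r • (1 : Matrix ι ι ℝ) := by rw [smul_smul, mul_comm]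

theorem Matrix.PosDef.add_smul_one {ι : Type*} [DecidableEq ι] {X : Matrix ι ι ℝ} {r : ℝ} (hX : X.PosDef) (hr : 0 ≤ r) :
    (X + r • (1 : Matrix ι ι ℝ)).PosDef :=
  hX.add_posSemidef (Matrix.PosSemidef.one.smul hr)

/-- With `W = X⁻¹` and `V = (X + r)⁻¹`, the resolvent identity turns the two differences into `r V W
V` and `r W V W`. -/
theorem Matrix.PosDef.inv_mul_inv_add_le {X : Matrix ι ι ℝ} {r : ℝ} (hX : X.PosDef)
    (hr : 0 ≤ r) :
    (X + r • (1 : Matrix ι ι ℝ))⁻¹ * (X + r • (1 : Matrix ι ι ℝ))⁻¹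
        ≤ X⁻¹ * (X + r • (1 : Matrix ι ι ℝ))⁻¹ ∧
      X⁻¹ * (X + r • (1 : Matrix ι ι ℝ))⁻¹ ≤ X⁻¹ * X⁻¹ := by
  have hM := hX.add_smul_one hr
  obtain ⟨e1, e2⟩ := hX.resolvent hM
  set V := (X + r • (1 : Matrix ι ι ℝ))⁻¹
  set W := X⁻¹
  have hV : 0 ≤ V := hM.inv.posSemidef.nonneg
  have hW : 0 ≤ W := hX.inv.posSemidef.nonneg
  constructor
  · have h := smul_nonneg hr (star_left_conjugate_nonneg hW V)
    rw [(IsSelfAdjoint.of_nonneg hV).star_eq] at h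
    have : W * V - V * V = r • (V * W * V) := by
      conv_lhs => rw [e2]
      rw [add_mul, smul_mul_assoc, add_sub_cancel_left]
    exact sub_nonneg.mp (this ▸ h)
  · have h := smul_nonneg hr (star_left_conjugate_nonneg hV W)
    rw [(IsSelfAdjoint.of_nonneg hW).star_eq] at h
    have : W * W - W * V = r • (W * V * W) := by
      conv_lhs => rw [show W * W = W * (V + r • (V * W)) by rw [← e2]]
      rw [mul_add, mul_smul_comm, add_sub_cancel_left, mul_assoc]
    exact sub_nonneg.mp (this ▸ h)

theorem Matrix.PosDef.inv_le_smul_inv {M N : Matrix ι ι ℝ} {k : ℝ} (hM : M.PosDef) (hk : 0 < k)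
    (h : M ≤ k • N) : N⁻¹ ≤ k • M⁻¹ := by
  have hN : N.PosDef := by
    have := (hM.of_le h).smul (inv_pos.mpr hk)
    rwa [smul_smul, inv_mul_cancel₀ hk.ne', one_smul] at this
  have h1 := hM.inv_antitone h
  have h2 : (k • N)⁻¹ = k⁻¹ • N⁻¹ := by
    apply Matrix.inv_eq_left_inv
    rw [smul_mul_smul_comm, hN.inv_mul_self, inv_mul_cancel₀ hk.ne', one_smul]
  rw [h2] at h1
  calc N⁻¹ = k • k⁻¹ • N⁻¹ := by rw [smul_smul, mul_inv_cancel₀ hk.ne', one_smul]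
    _ ≤ k • M⁻¹ := by gcongr

/-- `u` is an upper barrier for `A`: it exceeds all eigenvalues, and the trace of the resolvent
at `u` is at most `φ`. -/
def IsBarrier (φ : ℝ) (A : Matrix ι ι ℝ) (u : ℝ) : Prop :=
  (u • (1 : Matrix ι ι ℝ) - A).PosDef ∧ ((u • (1 : Matrix ι ι ℝ) - A)⁻¹).trace ≤ φ

theorem IsBarrier.isHermitian {φ u : ℝ}
    {A : Matrix ι ι ℝ} (h : IsBarrier φ A u) : A.IsHermitian := by
  have h1 : (u • (1 : Matrix ι ι ℝ)).IsHermitian :=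
    IsSelfAdjoint.smul (IsSelfAdjoint.all u) (IsSelfAdjoint.one _)
  have h2 := h1.sub h.1.isHermitian
  rwa [sub_sub_cancel] at h2

/-- Raising `u` by `r` lowers the potential by exactly `r tr (X⁻¹ (X + r)⁻¹)`; adding `b` raises it
by at most the quadratic term divided by `1 - t`. Condition `hq` says that the gain pays for the
loss. -/
theorem IsBarrier.add_of_le {A b : Matrix ι ι ℝ} {φ u r t : ℝ} (h : IsBarrier φ A u)
    (hr : 0 ≤ r) (ht : 0 < t) (ht1 : t < 1) (hb : 0 ≤ b)
    (hbM : b ≤ t • ((u • (1 : Matrix ι ι ℝ) - A) + r • (1 : Matrix ι ι ℝ)))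
    (hq : (((u • (1 : Matrix ι ι ℝ) - A) + r • (1 : Matrix ι ι ℝ))⁻¹ * b *
        ((u • (1 : Matrix ι ι ℝ) - A) + r • (1 : Matrix ι ι ℝ))⁻¹).trace ≤
      (1 - t) * (r * ((u • (1 : Matrix ι ι ℝ) - A)⁻¹ *
        ((u • (1 : Matrix ι ι ℝ) - A) + r • (1 : Matrix ι ι ℝ))⁻¹).trace)) :
    IsBarrier φ (A + b) (u + r) := by
  obtain ⟨hX, hφ⟩ := h
  have hM := hX.add_smul_one hr
  obtain ⟨h1, h2⟩ := hM.trace_inv_sub_le ht ht1 hb hbM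
  have e : (u + r) • (1 : Matrix ι ι ℝ) - (A + b)
      = (u • (1 : Matrix ι ι ℝ) - A) + r • (1 : Matrix ι ι ℝ) - b := by module
  refine ⟨e ▸ h1, e ▸ h2.trans ?_⟩
  have h1t : 0 < 1 - t := by linarith
  have h3 := congrArg Matrix.trace (hX.resolvent hM).1
  rw [Matrix.trace_add, Matrix.trace_smul, smul_eq_mul] at h3
  rw [mul_comm (1 - t), ← div_le_iff₀ h1t] at hq
  linarith

/-- The gap passes from `X` to `M = X - r` and then to `M + b`, with `M ≥ (1 - t) X`. One factor `1
- t` in `hq` pays for replacing `M⁻¹ X⁻¹` by `X⁻²`, the other for the second-order effect of `b`. -/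
theorem IsBarrier.sub_of_le {A b : Matrix ι ι ℝ} {φ u r t : ℝ} (h : IsBarrier φ A u)
    (hr : 0 ≤ r) (ht : 0 < t) (ht1 : t < 1) (hb : 0 ≤ b) (hrφ : r * φ ≤ t)
    (hbX : b ≤ t • (u • (1 : Matrix ι ι ℝ) - A))
    (hq : r * ((u • (1 : Matrix ι ι ℝ) - A)⁻¹ * (u • (1 : Matrix ι ι ℝ) - A)⁻¹).trace ≤
      (1 - t) ^ 2 * ((u • (1 : Matrix ι ι ℝ) - A)⁻¹ * b * (u • (1 : Matrix ι ι ℝ) - A)⁻¹).trace) :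
    IsBarrier φ (A - b) (u - r) := by
  obtain ⟨hX, hφ⟩ := h
  set X := u • (1 : Matrix ι ι ℝ) - A with hXdef
  have h1t : 0 < 1 - t := by linarith
  set M := X - r • (1 : Matrix ι ι ℝ) with hMdef
  have hXM : (1 - t) • X ≤ M := by
    have := hX.smul_one_le hφ hr ht hrφ
    calc (1 - t) • X = X - t • X := by module
      _ ≤ M := by rw [hMdef]; gcongr
  have hM : M.PosDef := (hX.smul h1t).of_le hXM
  have hMX : M + r • (1 : Matrix ι ι ℝ) = X := by rw [hMdef]; abel
  have e : (u - r) • (1 : Matrix ι ι ℝ) - (A - b) = M + b := by rw [hMdef, hXdef]; module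
  have hbM : b ≤ (t / (1 - t)) • M := by
    calc b ≤ t • X := hbX
      _ = (t / (1 - t)) • ((1 - t) • X) := by rw [smul_smul, div_mul_cancel₀ _ h1t.ne']
      _ ≤ _ := by
        have : 0 ≤ t / (1 - t) := by positivity
        gcongr
  refine ⟨e ▸ hM.add_posSemidef (Matrix.nonneg_iff_posSemidef.mp hb), ?_⟩
  rw [e]
  refine (hM.trace_inv_add_le (div_pos ht h1t) hb hbM).trans (le_trans ?_ hφ)
  have h3 := congrArg Matrix.trace (hM.resolvent (hMX ▸ hX)).1
  rw [hMX, Matrix.trace_add, Matrix.trace_smul, smul_eq_mul] at h3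
  have hdiv : (M⁻¹ * b * M⁻¹).trace / (1 + t / (1 - t)) = (1 - t) * (M⁻¹ * b * M⁻¹).trace := by
    have : 1 + t / (1 - t) = (1 - t)⁻¹ := by field_simp; ring
    rw [this, div_inv_eq_mul, mul_comm]
  have hW : 0 ≤ X⁻¹ := hX.inv.posSemidef.nonneg
  have h4 : (M⁻¹ * X⁻¹).trace ≤ (1 - t)⁻¹ * (X⁻¹ * X⁻¹).trace := by
    have h5 : M⁻¹ ≤ (1 - t)⁻¹ • X⁻¹ := by
      refine hX.inv_le_smul_inv (inv_pos.mpr h1t) ?_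
      calc X = (1 - t)⁻¹ • (1 - t) • X := by rw [smul_smul, inv_mul_cancel₀ h1t.ne', one_smul]
        _ ≤ _ := smul_le_smul_of_nonneg_left hXM (inv_nonneg.mpr h1t.le)
    have h7 := Matrix.trace_mul_le_trace_mul h5 hW
    rwa [smul_mul_assoc, Matrix.trace_smul, smul_eq_mul] at h7
  have h8 : (X⁻¹ * b * X⁻¹).trace ≤ (M⁻¹ * b * M⁻¹).trace := by
    obtain ⟨h9, h10⟩ := hM.inv_mul_inv_add_le hr
    have h11 := Matrix.trace_mul_le_trace_mul (h9.trans h10) hb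
    rw [hMX, mul_assoc, Matrix.trace_mul_comm, mul_assoc M⁻¹, Matrix.trace_mul_comm M⁻¹] at h11
    exact h11
  have h12 : r * (M⁻¹ * X⁻¹).trace ≤ (1 - t) * (M⁻¹ * b * M⁻¹).trace := by
    calc r * (M⁻¹ * X⁻¹).trace ≤ r * ((1 - t)⁻¹ * (X⁻¹ * X⁻¹).trace) := by gcongr
      _ = (1 - t)⁻¹ * (r * (X⁻¹ * X⁻¹).trace) := by ring
      _ ≤ (1 - t)⁻¹ * ((1 - t) ^ 2 * (X⁻¹ * b * X⁻¹).trace) := by gcongr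
      _ = (1 - t) * (X⁻¹ * b * X⁻¹).trace := by field_simp
      _ ≤ _ := by gcongr
  rw [hdiv, h3]
  linarith

end SpectralBounds

/-! ### The soft maximum of the spectrum: monotonicity, attainment, continuity. -/

section SoftMax

open Matrix
open scoped MatrixOrder

variable {ι : Type*} [Fintype ι] [DecidableEq ι]

theorem IsBarrier.mono {A B : Matrix ι ι ℝ} {φ u : ℝ} (h : IsBarrier φ B u) (hAB : A ≤ B) :
    IsBarrier φ A u := by
  have hle : u • (1 : Matrix ι ι ℝ) - B ≤ u • (1 : Matrix ι ι ℝ) - A := by gcongr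
  exact ⟨h.1.of_le hle, (Matrix.trace_le_trace (h.1.inv_antitone hle)).trans h.2⟩

theorem IsBarrier.add_smul_one {A : Matrix ι ι ℝ} {φ u : ℝ} (h : IsBarrier φ A u) (d : ℝ) :
    IsBarrier φ (A + d • (1 : Matrix ι ι ℝ)) (u + d) := by
  have e : (u + d) • (1 : Matrix ι ι ℝ) - (A + d • (1 : Matrix ι ι ℝ))
      = u • (1 : Matrix ι ι ℝ) - A := by module
  unfold IsBarrier
  rwa [e]

theorem IsBarrier.le_smul_one {A : Matrix ι ι ℝ} {φ u : ℝ} (h : IsBarrier φ A u) :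
    A ≤ u • (1 : Matrix ι ι ℝ) :=
  sub_nonneg.mp h.1.posSemidef.nonneg

theorem isBarrier_zero [Nonempty ι] {φ : ℝ} (hφ : 0 < φ) :
    IsBarrier φ (0 : Matrix ι ι ℝ) (Fintype.card ι / φ) := by
  have hu : (0 : ℝ) < Fintype.card ι / φ := div_pos (by exact_mod_cast Fintype.card_pos) hφ
  refine ⟨by simpa using (Matrix.PosDef.one (n := ι) (R := ℝ)).smul hu, ?_⟩
  have e : ((Fintype.card ι / φ) • (1 : Matrix ι ι ℝ) - 0)⁻¹
      = (Fintype.card ι / φ)⁻¹ • (1 : Matrix ι ι ℝ) := by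
    apply Matrix.inv_eq_left_inv
    rw [sub_zero, smul_mul_smul_comm, one_mul, inv_mul_cancel₀ hu.ne', one_smul]
  rw [e, Matrix.trace_smul, Matrix.trace_one, smul_eq_mul, inv_div]
  have : (Fintype.card ι : ℝ) ≠ 0 := by exact_mod_cast Fintype.card_ne_zero
  rw [div_mul_cancel₀ _ this]

theorem Matrix.smul_one_le_smul_one_iff [Nonempty ι] {a b : ℝ} :
    a • (1 : Matrix ι ι ℝ) ≤ b • (1 : Matrix ι ι ℝ) ↔ a ≤ b := by
  rw [Matrix.smul_one_eq_conj (one_mem _), Matrix.smul_one_eq_conj (one_mem _),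
    Matrix.conj_diagonal_le_iff (one_mem _)]
  exact forall_const ι

theorem Matrix.IsHermitian.neg_norm_smul_one_le {A : Matrix ι ι ℝ} (hA : A.IsHermitian) :
    (-‖A‖) • (1 : Matrix ι ι ℝ) ≤ A := by
  have := hA.neg.le_norm_smul_one
  rw [norm_neg] at this
  rw [neg_smul]
  exact neg_le.mp this

theorem IsBarrier.neg_norm_le [Nonempty ι] {A : Matrix ι ι ℝ} {φ u : ℝ} (h : IsBarrier φ A u)
    (hA : A.IsHermitian) : -‖A‖ ≤ u :=
  Matrix.smul_one_le_smul_one_iff.mp (hA.neg_norm_smul_one_le.trans h.le_smul_one)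

theorem Matrix.IsHermitian.isBarrier [Nonempty ι] {A : Matrix ι ι ℝ} {φ : ℝ} (hφ : 0 < φ)
    (hA : A.IsHermitian) : IsBarrier φ A (Fintype.card ι / φ + ‖A‖) := by
  have := (isBarrier_zero (ι := ι) hφ).add_smul_one ‖A‖
  rw [zero_add] at this
  exact this.mono hA.le_norm_smul_one

/-- The soft maximum of the spectrum of the symmetric part of `A`: its least upper barrier. -/
noncomputable def softMax (φ : ℝ) (A : Matrix ι ι ℝ) : ℝ :=
  sInf {u | IsBarrier φ ((2 : ℝ)⁻¹ • (A + Aᴴ)) u}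

theorem Matrix.IsHermitian.softMax_eq {A : Matrix ι ι ℝ} (φ : ℝ) (hA : A.IsHermitian) :
    softMax φ A = sInf {u | IsBarrier φ A u} := by
  have : (2 : ℝ)⁻¹ • (A + Aᴴ) = A := by rw [hA.eq]; module
  rw [softMax, this]

section

variable [Nonempty ι] {φ : ℝ}

theorem softMax_le {A : Matrix ι ι ℝ} {u : ℝ} (hA : A.IsHermitian) (h : IsBarrier φ A u) :
    softMax φ A ≤ u := by
  rw [hA.softMax_eq]
  exact csInf_le ⟨-‖A‖, fun v hv => hv.neg_norm_le hA⟩ h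

theorem le_softMax (hφ : 0 < φ) {A : Matrix ι ι ℝ} {u : ℝ} (hA : A.IsHermitian)
    (h : ∀ v, IsBarrier φ A v → u ≤ v) : u ≤ softMax φ A := by
  rw [hA.softMax_eq]
  exact le_csInf ⟨_, hA.isBarrier hφ⟩ h

theorem softMax_le_softMax (hφ : 0 < φ) {A B : Matrix ι ι ℝ} (hA : A.IsHermitian)
    (hB : B.IsHermitian) (hAB : A ≤ B) : softMax φ A ≤ softMax φ B :=
  le_softMax hφ hB fun _ hv => softMax_le hA (hv.mono hAB)

theorem softMax_zero_le (hφ : 0 < φ) : softMax φ (0 : Matrix ι ι ℝ) ≤ Fintype.card ι / φ :=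
  softMax_le Matrix.isHermitian_zero (isBarrier_zero hφ)

theorem softMax_le_add_norm (hφ : 0 < φ) {A B : Matrix ι ι ℝ} (hA : A.IsHermitian)
    (hB : B.IsHermitian) : softMax φ A ≤ softMax φ B + ‖A - B‖ := by
  rw [← sub_le_iff_le_add]
  refine le_softMax hφ hB fun v hv => ?_
  rw [sub_le_iff_le_add]
  refine softMax_le hA ((hv.add_smul_one ‖A - B‖).mono ?_)
  have := (hA.sub hB).le_norm_smul_one
  rwa [sub_le_iff_le_add'] at this

theorem neg_norm_le_softMax (hφ : 0 < φ) {A : Matrix ι ι ℝ} (hA : A.IsHermitian) :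
    -‖A‖ ≤ softMax φ A :=
  le_softMax hφ hA fun _ hv => hv.neg_norm_le hA

theorem abs_softMax_le (hφ : 0 < φ) {A : Matrix ι ι ℝ} (hA : A.IsHermitian) :
    |softMax φ A| ≤ Fintype.card ι / φ + ‖A‖ := by
  have h0 : (0 : ℝ) ≤ Fintype.card ι / φ := by positivity
  exact abs_le.mpr ⟨by linarith [neg_norm_le_softMax hφ hA], softMax_le hA (hA.isBarrier hφ)⟩

theorem le_softMax_smul_one (hφ : 0 < φ) {A : Matrix ι ι ℝ} (hA : A.IsHermitian) :
    A ≤ softMax φ A • (1 : Matrix ι ι ℝ) := by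
  obtain ⟨U, hU, w, h⟩ := hA.exists_unitary_diagonal
  rw [Matrix.smul_one_eq_conj hU]
  conv_lhs => rw [h]
  rw [Matrix.conj_diagonal_le_iff hU]
  intro i
  refine le_softMax hφ hA fun v hv => ?_
  have := hv.le_smul_one
  rw [Matrix.smul_one_eq_conj hU, h, Matrix.conj_diagonal_le_iff hU] at this
  exact this i

/-- The infimum is attained, so each step of the iteration can start from the barrier `softMax φ A`
itself. -/
theorem isBarrier_softMax (hφ : 0 < φ) {A : Matrix ι ι ℝ} (hA : A.IsHermitian) :
    IsBarrier φ A (softMax φ A) := by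
  set X := softMax φ A • (1 : Matrix ι ι ℝ) - A with hXdef
  -- The uniform gap `φ⁻¹` of all barriers passes to the infimum, so the limiting matrix cannot
  -- become singular.
  have hX1 : φ⁻¹ • (1 : Matrix ι ι ℝ) ≤ X := by
    obtain ⟨U, hU, w, h⟩ := hA.exists_unitary_diagonal
    have key : A ≤ (softMax φ A - φ⁻¹) • (1 : Matrix ι ι ℝ) := by
      rw [Matrix.smul_one_eq_conj hU]
      conv_lhs => rw [h]
      rw [Matrix.conj_diagonal_le_iff hU]
      intro i
      rw [le_sub_iff_add_le]
      refine le_softMax hφ hA fun v hv => ?_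
      have h1 := hv.1.smul_one_le hv.2 (inv_nonneg.mpr hφ.le) one_pos
        (inv_mul_cancel₀ hφ.ne').le
      have h2 : A ≤ (v - φ⁻¹) • (1 : Matrix ι ι ℝ) := by
        rw [one_smul, le_sub_comm] at h1
        rwa [sub_smul]
      rw [Matrix.smul_one_eq_conj hU, h, Matrix.conj_diagonal_le_iff hU] at h2
      linarith [h2 i]
    rw [sub_smul, le_sub_comm] at key
    exact key
  have hX : X.PosDef := (Matrix.PosDef.one.smul (inv_pos.mpr hφ)).of_le hX1
  refine ⟨hX, le_of_forall_pos_le_add fun e he => ?_⟩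
  -- Since `X ≥ φ⁻¹`, lowering the barrier from `v` to the infimum multiplies the trace by at most
  -- `1 + (v - softMax φ A) φ`, adding at most `(v - softMax φ A) φ²`; hence the tolerance `e / φ²`.
  obtain ⟨v, hv, hvlt⟩ := exists_lt_of_csInf_lt (s := {u | IsBarrier φ A u})
    ⟨_, hA.isBarrier hφ⟩ (show sInf {u | IsBarrier φ A u} < softMax φ A + e / φ ^ 2 by
      rw [← hA.softMax_eq]; exact lt_add_of_pos_right _ (by positivity))
  have hr : 0 ≤ v - softMax φ A := sub_nonneg.mpr (softMax_le hA hv)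
  set M := v • (1 : Matrix ι ι ℝ) - A with hMdef
  have hk : 0 < 1 + (v - softMax φ A) * φ := by positivity
  have hM : M ≤ (1 + (v - softMax φ A) * φ) • X := by
    calc M = X + ((v - softMax φ A) * φ) • φ⁻¹ • (1 : Matrix ι ι ℝ) := by
          rw [smul_smul, mul_assoc, mul_inv_cancel₀ hφ.ne', hMdef, hXdef]; module
      _ ≤ X + ((v - softMax φ A) * φ) • X := by gcongr
      _ = _ := by module
  have h1 := Matrix.trace_le_trace (hv.1.inv_le_smul_inv hk hM)
  rw [Matrix.trace_smul, smul_eq_mul] at h1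
  calc (X⁻¹).trace ≤ (1 + (v - softMax φ A) * φ) * (M⁻¹).trace := h1
    _ ≤ (1 + (v - softMax φ A) * φ) * φ := by gcongr; exact hv.2
    _ = φ + (v - softMax φ A) * φ ^ 2 := by ring
    _ ≤ φ + e / φ ^ 2 * φ ^ 2 := by gcongr; linarith
    _ = φ + e := by field_simp

/-- This provides measurability. Symmetrizing in the definition makes the function 1-Lipschitz on
all matrices, not just on the symmetric ones. -/
theorem continuous_softMax (hφ : 0 < φ) : Continuous (softMax φ : Matrix ι ι ℝ → ℝ) := by
  have hherm : ∀ A : Matrix ι ι ℝ, ((2 : ℝ)⁻¹ • (A + Aᴴ)).IsHermitian := fun A => by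
    unfold Matrix.IsHermitian
    rw [Matrix.conjTranspose_smul, Matrix.conjTranspose_add, Matrix.conjTranspose_conjTranspose,
      star_trivial, add_comm]
  have hsym : ∀ A : Matrix ι ι ℝ, softMax φ A = softMax φ ((2 : ℝ)⁻¹ • (A + Aᴴ)) := fun A => by
    rw [(hherm A).softMax_eq, softMax]
  have hlip : LipschitzWith 1 (softMax φ : Matrix ι ι ℝ → ℝ) := by
    refine LipschitzWith.of_le_add fun A B => ?_
    rw [hsym A, hsym B]
    refine (softMax_le_add_norm hφ (hherm A) (hherm B)).trans ?_
    rw [dist_eq_norm]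
    gcongr
    have e : (2 : ℝ)⁻¹ • (A + Aᴴ) - (2 : ℝ)⁻¹ • (B + Bᴴ) = (2 : ℝ)⁻¹ • ((A - B) + (A - B)ᴴ) := by
      rw [Matrix.conjTranspose_sub]; module
    rw [e, norm_smul]
    have := norm_add_le (A - B) (A - B)ᴴ
    rw [Matrix.l2_opNorm_conjTranspose] at this
    rw [Real.norm_of_nonneg (by norm_num)]
    linarith
  exact hlip.continuous

end

end SoftMax

/-! ### Mean-excess bounds: stability under averaging and conversion to tails. -/

section TailBounds

open Set Filter Topology

theorem lintegral_Ioi_affine_rpow {c η p q r₀ : ℝ} (hc : 0 ≤ c) (hη : 0 < η) (hq : 0 < q)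
    (h₀ : 0 < p + q * r₀) :
    ∫⁻ r in Ioi r₀, ENNReal.ofReal (c * (p + q * r) ^ (-(1 + η))) =
      ENNReal.ofReal (c * (p + q * r₀) ^ (-η) / (q * η)) := by
  have hpos : ∀ r ∈ Ici r₀, 0 < p + q * r := fun r hr => by
    have : q * r₀ ≤ q * r := by gcongr; exact hr
    linarith
  have hder : ∀ r ∈ Ici r₀, HasDerivAt (fun r => -(c * (p + q * r) ^ (-η) / (q * η)))
      (c * (p + q * r) ^ (-(1 + η))) r := by
    intro r hr
    have h1 : HasDerivAt (fun r => p + q * r) q r := by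
      simpa using ((hasDerivAt_id r).const_mul q).const_add p
    have h2 := ((h1.rpow_const (p := -η) (Or.inl (hpos r hr).ne')).const_mul c).div_const (q * η)
    refine h2.neg.congr_deriv ?_
    rw [show -η - 1 = -(1 + η) by ring]
    field_simp
  have hnonneg : ∀ r ∈ Ioi r₀, 0 ≤ c * (p + q * r) ^ (-(1 + η)) := fun r hr =>
    mul_nonneg hc (Real.rpow_nonneg (hpos r (Ioi_subset_Ici_self hr)).le _)
  have htop : Tendsto (fun r => p + q * r) atTop atTop :=
    tendsto_atTop_add_const_left _ _ (tendsto_id.const_mul_atTop hq)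
  have hlim : Tendsto (fun r => -(c * (p + q * r) ^ (-η) / (q * η))) atTop (𝓝 0) := by
    have := (((tendsto_rpow_neg_atTop hη).comp htop).const_mul c).div_const (q * η)
    simpa using this.neg
  have hint := integrableOn_Ioi_deriv_of_nonneg' hder hnonneg hlim
  have hval := integral_Ioi_of_hasDerivAt_of_tendsto' hder hint hlim
  rw [← ofReal_integral_eq_lintegral_ofReal hint
    ((ae_restrict_iff' measurableSet_Ioi).mpr (Eventually.of_forall hnonneg)), hval]
  simp

variable {α : Type*} [MeasurableSpace α]

/-- The mean excess of `Z` above each level `a ≥ c` is at most the one of a random variable with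
tail `c / a ^ (1 + η)`. -/
def HasExcessBound (c η : ℝ) (ν : Measure α) (Z : α → ℝ) : Prop :=
  ∀ a, c ≤ a → ∫⁻ x, ENNReal.ofReal (Z x - a) ∂ν ≤ ENNReal.ofReal (c * a ^ (-η) / η)

variable {ν : Measure α} {c η : ℝ}

theorem lintegral_ofReal_eq_lintegral_meas_lt {f : α → ℝ} (hf : AEMeasurable f ν) :
    ∫⁻ x, ENNReal.ofReal (f x) ∂ν = ∫⁻ r in Ioi 0, ν {x | r < f x} := by
  have h := lintegral_eq_lintegral_meas_lt ν (f := fun x => max (f x) 0)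
    (Eventually.of_forall fun x => le_max_right _ _) (hf.max aemeasurable_const)
  have e : ∀ x, ENNReal.ofReal (max (f x) 0) = ENNReal.ofReal (f x) := fun x => by
    rw [ENNReal.ofReal_max]; simp
  simp only [e] at h
  rw [h]
  refine setLIntegral_congr_fun measurableSet_Ioi fun r (hr : 0 < r) => ?_
  simp [hr.not_gt]

theorem hasExcessBound_of_tail [IsFiniteMeasure ν] {Y : α → ℝ} (hY : AEMeasurable Y ν)
    (hc : 0 < c) (hη : 0 < η) (h : ∀ s, c ≤ s → ν.real {x | s ≤ Y x} ≤ c / s ^ (1 + η)) :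
    HasExcessBound c η ν Y := by
  intro a ha
  have hYa : AEMeasurable (fun x => Y x - a) ν := hY.sub aemeasurable_const
  rw [lintegral_ofReal_eq_lintegral_meas_lt hYa]
  have hint := lintegral_Ioi_affine_rpow (c := c) (η := η) (p := a) (q := 1) (r₀ := 0) hc.le hη
    one_pos (by linarith)
  rw [mul_zero, add_zero, one_mul] at hint
  rw [← hint]
  refine setLIntegral_mono' measurableSet_Ioi fun r (hr : 0 < r) => ?_
  calc ν {x | r < Y x - a} ≤ ν {x | a + 1 * r ≤ Y x} :=
        measure_mono fun x (hx : r < Y x - a) => show a + 1 * r ≤ Y x by linarith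
    _ = ENNReal.ofReal (ν.real {x | a + 1 * r ≤ Y x}) := (ofReal_measureReal).symm
    _ ≤ _ := by
        refine ENNReal.ofReal_le_ofReal ((h _ (by linarith)).trans_eq ?_)
        rw [Real.rpow_neg (by linarith), div_eq_mul_inv]

/-- Convexity of the positive part. Above a level `a ≥ c`, the missing weight `1 - ∑ w` only helps,
as it contributes `(1 - ∑ w) (c - a) ≤ 0`. -/
theorem HasExcessBound.of_le_average {κ : Type*} [Fintype κ] {Y : κ → α → ℝ} {w : κ → ℝ}
    {Z : α → ℝ} (hc : 0 < c) (hY : ∀ j, AEMeasurable (Y j) ν)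
    (h : ∀ j, 0 < w j → HasExcessBound c η ν (Y j)) (hw : ∀ j, 0 ≤ w j) (hw1 : ∑ j, w j ≤ 1)
    (hZ : ∀ᵐ x ∂ν, Z x ≤ c + ∑ j, w j * (Y j x - c)) : HasExcessBound c η ν Z := by
  intro a ha
  have ha0 : 0 < a := hc.trans_le ha
  have hYa : ∀ j, AEMeasurable (fun x => Y j x - a) ν := fun j => (hY j).sub aemeasurable_const
  calc ∫⁻ x, ENNReal.ofReal (Z x - a) ∂ν
      ≤ ∫⁻ x, ∑ j, ENNReal.ofReal (w j) * ENNReal.ofReal (Y j x - a) ∂ν := by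
        refine lintegral_mono_ae ?_
        filter_upwards [hZ] with x hx
        have h1 : Z x - a ≤ ∑ j, w j * (Y j x - a) := by
          have e : ∑ j, w j * (Y j x - c) = ∑ j, w j * (Y j x - a) + (∑ j, w j) * (a - c) := by
            rw [Finset.sum_mul, ← Finset.sum_add_distrib]
            exact Finset.sum_congr rfl fun j _ => by ring
          nlinarith
        refine (ENNReal.ofReal_le_ofReal h1).trans ?_
        refine (ENNReal.ofReal_le_ofReal (Finset.sum_le_sum fun j _ =>
          mul_le_mul_of_nonneg_left (le_max_left (Y j x - a) 0) (hw j))).trans ?_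
        rw [ENNReal.ofReal_sum_of_nonneg fun j _ => mul_nonneg (hw j) (le_max_right _ _)]
        refine Finset.sum_le_sum fun j _ => ?_
        rw [ENNReal.ofReal_mul (hw j), ENNReal.ofReal_max]
        simp
    _ = ∑ j, ENNReal.ofReal (w j) * ∫⁻ x, ENNReal.ofReal (Y j x - a) ∂ν := by
        rw [lintegral_finsetSum' _ fun j _ => (hYa j).ennreal_ofReal.const_mul _]
        refine Finset.sum_congr rfl fun j _ => ?_
        rw [lintegral_const_mul'' _ (hYa j).ennreal_ofReal]
    _ ≤ ∑ j, ENNReal.ofReal (w j) * ENNReal.ofReal (c * a ^ (-η) / η) := by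
        refine Finset.sum_le_sum fun j _ => ?_
        rcases (hw j).eq_or_lt with h0 | h0
        · simp [← h0]
        · gcongr
          exact h j h0 a ha
    _ = ENNReal.ofReal (∑ j, w j) * ENNReal.ofReal (c * a ^ (-η) / η) := by
        rw [ENNReal.ofReal_sum_of_nonneg fun j _ => hw j, Finset.sum_mul]
    _ ≤ _ := by
        refine mul_le_of_le_one_left bot_le ?_
        exact ENNReal.ofReal_le_one.mpr hw1

/-- Markov's inequality for `(Z - a)₊`, which is at least `a / η` on the event. The power of a
genuine tail is recovered, at the level `a (1 + 1/η)` instead of `a`. -/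
theorem HasExcessBound.measure_le {Z : α → ℝ} (hZm : AEMeasurable Z ν)
    (hZ : HasExcessBound c η ν Z) (hc : 0 < c) (hη : 0 < η) {a : ℝ} (ha : c ≤ a) :
    ν {x | a * (1 + 1 / η) ≤ Z x} ≤ ENNReal.ofReal (c * a ^ (-(1 + η))) := by
  have ha0 : 0 < a := hc.trans_le ha
  have hm := mul_meas_ge_le_lintegral₀ (μ := ν) (hZm.sub aemeasurable_const).ennreal_ofReal
    (ENNReal.ofReal (a / η)) (f := fun x => ENNReal.ofReal (Z x - a))
  have hsub : {x | a * (1 + 1 / η) ≤ Z x} ⊆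
      {x | ENNReal.ofReal (a / η) ≤ ENNReal.ofReal (Z x - a)} := by
    intro x (hx : a * (1 + 1 / η) ≤ Z x)
    refine ENNReal.ofReal_le_ofReal ?_
    have : a * (1 + 1 / η) = a + a / η := by ring
    linarith
  have h1 : ENNReal.ofReal (a / η) * ν {x | a * (1 + 1 / η) ≤ Z x} ≤
      ENNReal.ofReal (c * a ^ (-η) / η) :=
    (mul_le_mul_right (measure_mono hsub) _).trans (hm.trans (hZ a ha))
  have h2 : ENNReal.ofReal (c * a ^ (-η) / η) =
      ENNReal.ofReal (a / η) * ENNReal.ofReal (c * a ^ (-(1 + η))) := by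
    rw [← ENNReal.ofReal_mul (by positivity), neg_add, Real.rpow_add ha0, Real.rpow_neg_one]
    congr 1
    field_simp
  rw [h2] at h1
  refine (ENNReal.mul_le_mul_iff_right ?_ ENNReal.ofReal_ne_top).mp h1
  exact (ENNReal.ofReal_pos.mpr (by positivity)).ne'

/-- On `F`, bound `Z` by `a + (Z - a)₊`. This is the mean lost when `Z` is discarded on a rare
event. -/
theorem HasExcessBound.setLIntegral_le {Z : α → ℝ}
    (hZ : HasExcessBound c η ν Z) (hc : 0 < c) (hη : 0 < η) {a : ℝ} (ha : c ≤ a) {F : Set α}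
    (hF : ν F ≤ ENNReal.ofReal (c * a ^ (-(1 + η)))) :
    ∫⁻ x in F, ENNReal.ofReal (Z x) ∂ν ≤ ENNReal.ofReal (c * (1 + 1 / η) * a ^ (-η)) := by
  have ha0 : 0 < a := hc.trans_le ha
  calc ∫⁻ x in F, ENNReal.ofReal (Z x) ∂ν
      ≤ ∫⁻ x in F, (ENNReal.ofReal a + ENNReal.ofReal (Z x - a)) ∂ν := by
        refine lintegral_mono fun x => ?_
        calc ENNReal.ofReal (Z x) = ENNReal.ofReal (a + (Z x - a)) := by congr 1; ring
          _ ≤ _ := ENNReal.ofReal_add_le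
    _ = ENNReal.ofReal a * ν F + ∫⁻ x in F, ENNReal.ofReal (Z x - a) ∂ν := by
        rw [lintegral_add_left measurable_const, setLIntegral_const]
    _ ≤ ENNReal.ofReal a * ENNReal.ofReal (c * a ^ (-(1 + η)))
        + ENNReal.ofReal (c * a ^ (-η) / η) := by
        gcongr
        exact (setLIntegral_le_lintegral _ _).trans (hZ a ha)
    _ = _ := by
        rw [← ENNReal.ofReal_mul ha0.le, ← ENNReal.ofReal_add (by positivity) (by positivity)]
        congr 1
        rw [neg_add, Real.rpow_add ha0, Real.rpow_neg_one]
        field_simp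

end TailBounds

instance matrixBorelSpace (n : ℕ) : BorelSpace (Matrix (Fin n) (Fin n) ℝ) :=
  inferInstanceAs (BorelSpace (Fin n → Fin n → ℝ))

/-! ### Weighted sums of spectral projections. -/

section SpectralProjections

open Matrix
open scoped MatrixOrder

variable {ι : Type*} [Fintype ι] [DecidableEq ι]

/-- Layer cake decomposition of a nonnegative function on a finite type. -/
theorem exists_layers (w : ι → ℝ) (m : ℝ) (hm : 0 ≤ m) (hw : ∀ i, 0 ≤ w i) (hwm : ∀ i, w i ≤ m) :
    ∃ μ : Finset ι → ℝ, (∀ S, 0 ≤ μ S) ∧ μ ∅ = 0 ∧ ∑ S, μ S ≤ m ∧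
      ∀ i, w i = ∑ S, if i ∈ S then μ S else 0 := by
  induction hk : (Finset.univ.filter fun i => w i ≠ 0).card using Nat.strong_induction_on
    generalizing w m with
  | _ k ih =>
  set T := Finset.univ.filter fun i => w i ≠ 0 with hT
  have hmemT : ∀ i, i ∈ T ↔ w i ≠ 0 := by simp [hT]
  rcases T.eq_empty_or_nonempty with h0 | h0
  · refine ⟨0, by simp, rfl, by simpa using hm, fun i => ?_⟩
    have : i ∉ T := by simp [h0]
    simpa [hmemT] using this
  -- The smallest positive value is peeled off the whole support `T`; the support shrinks and the
  -- maximum drops by that value, so the total weight stays at most `m`.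
  obtain ⟨i₀, hi₀, hmin⟩ := T.exists_min_image w h0
  set a := w i₀ with ha
  have ha0 : 0 < a := lt_of_le_of_ne (hw _) (Ne.symm ((hmemT _).mp hi₀))
  set w' : ι → ℝ := fun i => if i ∈ T then w i - a else 0 with hw'
  have hlt : (Finset.univ.filter fun i => w' i ≠ 0).card < k := by
    rw [← hk]
    refine Finset.card_lt_card ⟨fun i hi => ?_, fun hsub => ?_⟩
    · by_contra hiT
      simp [hw', hiT] at hi
    · have := hsub hi₀
      simp [hw', hi₀, ha] at this
  obtain ⟨μ, h1, h2, h3, h4⟩ := ih _ hlt w' (m - a) (sub_nonneg.mpr (hwm i₀))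
    (fun i => by
      by_cases h : i ∈ T
      · simpa [hw', h] using hmin i h
      · simp [hw', h])
    (fun i => by
      by_cases h : i ∈ T
      · simpa [hw', h] using hwm i
      · simpa [hw', h] using hwm i₀) rfl
  refine ⟨fun S => μ S + if S = T then a else 0, fun S => ?_, ?_, ?_, fun i => ?_⟩
  · have := h1 S
    positivity
  · simp [h2, h0.ne_empty.symm]
  · simp only [Finset.sum_add_distrib, Finset.sum_ite_eq', Finset.mem_univ, if_true]
    linarith
  · have e : ∀ S : Finset ι, (if i ∈ S then μ S + (if S = T then a else 0) else 0)
        = (if i ∈ S then μ S else 0) + if S = T then (if i ∈ T then a else 0) else 0 := by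
      intro S
      by_cases hS : S = T
      · subst hS
        by_cases hi : i ∈ T <;> simp [hi]
      · simp [hS]
    simp only [e, Finset.sum_add_distrib, ← h4 i, Finset.sum_ite_eq', Finset.mem_univ, if_true]
    by_cases h : i ∈ T
    · simp [hw', h]
    · have := (hmemT i).not.mp h
      simp [hw', h, not_not.mp this]

/-- The orthogonal projection onto the span of the columns of `U` with index in `S`. -/
def columnProj (U : Matrix ι ι ℝ) (S : Finset ι) : Matrix ι ι ℝ :=
  U * diagonal (fun i => if i ∈ S then (1 : ℝ) else 0) * star U

variable {U : Matrix ι ι ℝ}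

theorem conj_diagonal_mul_conj_diagonal (hU : U ∈ unitary (Matrix ι ι ℝ)) (v w : ι → ℝ) :
    (U * diagonal v * star U) * (U * diagonal w * star U)
      = U * diagonal (fun i => v i * w i) * star U := by
  rw [← Matrix.diagonal_mul_diagonal]
  calc _ = U * diagonal v * (star U * U) * diagonal w * star U := by simp only [mul_assoc]
    _ = _ := by rw [Unitary.star_mul_self_of_mem hU, mul_one]; simp only [mul_assoc]

theorem trace_conj_diagonal (hU : U ∈ unitary (Matrix ι ι ℝ)) (w : ι → ℝ) :
    (U * diagonal w * star U).trace = ∑ i, w i := by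
  rw [Matrix.trace_mul_comm, ← mul_assoc, Unitary.star_mul_self_of_mem hU, one_mul,
    Matrix.trace_diagonal]

theorem isStarProjection_columnProj (hU : U ∈ unitary (Matrix ι ι ℝ)) (S : Finset ι) :
    IsStarProjection (columnProj U S) := by
  constructor
  · rw [IsIdempotentElem, columnProj, conj_diagonal_mul_conj_diagonal hU]
    congr 3
    ext i
    by_cases h : i ∈ S <;> simp [h]
  · rw [IsSelfAdjoint, columnProj, star_mul, star_mul, star_star, mul_assoc]
    congr 2
    simp [Matrix.star_eq_conjTranspose]

theorem rank_columnProj_le (U : Matrix ι ι ℝ) (S : Finset ι) :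
    (columnProj U S).rank ≤ S.card := by
  refine (Matrix.rank_mul_le_left _ _).trans ((Matrix.rank_mul_le_right _ _).trans ?_)
  rw [Matrix.rank_diagonal]
  simp [Fintype.card_subtype]

theorem conj_diagonal_eq_sum_columnProj (U : Matrix ι ι ℝ) {κ : Type*} [Fintype κ] (w : ι → ℝ)
    (S : κ → Finset ι) (μ : κ → ℝ) (h : ∀ i, w i = ∑ k, if i ∈ S k then μ k else 0) :
    U * diagonal w * star U = ∑ k, μ k • columnProj U (S k) := by
  have : diagonal w = ∑ k, μ k • diagonal (fun i => if i ∈ S k then (1 : ℝ) else 0) := by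
    ext i j
    by_cases hij : i = j
    · subst hij
      simp [Matrix.sum_apply, h]
    · simp [Matrix.sum_apply, hij]
  rw [this, Finset.mul_sum, Finset.sum_mul]
  simp [columnProj]

/-- Write `b = C* C`. Then `b P b = C* (C P C*) C`, and `‖C P C*‖ = ‖P C*‖² = ‖P b P‖`, because the
two matrices are `T* T` and `T T*` for `T = P C*`. -/
theorem Matrix.mul_proj_mul_le {P b : Matrix ι ι ℝ} (hP : IsStarProjection P) (hb : 0 ≤ b) :
    b * P * b ≤ ‖P * b * P‖ • b := by
  obtain ⟨C, rfl⟩ := CStarAlgebra.nonneg_iff_eq_star_mul_self.mp hb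
  have hPs : star P = P := hP.isSelfAdjoint.star_eq
  have hPP : P * P = P := hP.isIdempotentElem
  have e1 : C * P * star C = star (P * star C) * (P * star C) := by
    rw [star_mul, star_star, hPs, mul_assoc C P (P * star C), ← mul_assoc P P, hPP, mul_assoc]
  have e2 : P * (star C * C) * P = (P * star C) * star (P * star C) := by
    rw [star_mul, star_star, hPs]; simp only [mul_assoc]
  have hn : ‖C * P * star C‖ = ‖P * (star C * C) * P‖ := by
    rw [e1, e2, CStarRing.norm_star_mul_self, CStarRing.norm_self_mul_star]
  have hsa : (C * P * star C).IsHermitian := by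
    rw [e1]; exact IsSelfAdjoint.star_mul_self _
  have := star_left_conjugate_le_conjugate hsa.le_norm_smul_one C
  rw [hn, mul_smul_comm, mul_one, smul_mul_assoc] at this
  simpa only [mul_assoc] using this

theorem Matrix.trace_columnProj_singleton_mul_le (hU : U ∈ unitary (Matrix ι ι ℝ)) (i : ι)
    {b : Matrix ι ι ℝ} (hb : 0 ≤ b) :
    (columnProj U {i} * b).trace ≤ ‖columnProj U {i} * b * columnProj U {i}‖ := by
  have hP := isStarProjection_columnProj hU {i}
  have htr : (columnProj U {i}).trace = 1 := by
    rw [columnProj, trace_conj_diagonal hU]; simp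
  set P := columnProj U {i}
  have hPs : star P = P := hP.isSelfAdjoint.star_eq
  have hPP : P * P = P := hP.isIdempotentElem
  have hsa : (P * b * P).IsHermitian := by
    have := star_left_conjugate_nonneg hb P
    rw [hPs] at this
    exact IsSelfAdjoint.of_nonneg this
  have h1 := star_left_conjugate_le_conjugate hsa.le_norm_smul_one P
  have e1 : P * (P * b * P) * P = P * b * P := by
    rw [← mul_assoc P, ← mul_assoc P, hPP, mul_assoc _ P P, hPP]
  rw [hPs, e1, mul_smul_comm, mul_one, smul_mul_assoc, hPP] at h1
  have h2 := Matrix.trace_le_trace h1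
  rw [Matrix.trace_smul, htr, smul_eq_mul, mul_one, Matrix.trace_mul_comm, ← mul_assoc, hPP] at h2
  exact h2

end SpectralProjections

/-! ### Consequences of (MSR) for linear and quadratic forms of the random matrix. -/

section RegularLaw

open Matrix Set
open scoped MatrixOrder

/-- The properties of the law of the random matrix: it is a probability measure on positive
semidefinite matrices with mean `1` and property (MSR). -/
structure IsRegularLaw {n : ℕ} (c η : ℝ) (ν : Measure (Matrix (Fin n) (Fin n) ℝ)) : Prop where
  isProbabilityMeasure : IsProbabilityMeasure ν
  nonneg : ∀ᵐ b ∂ν, 0 ≤ b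
  mean : HasMatrixExpectation (fun b => b) ν 1
  msr : MSR (fun b => b) ν c η

variable {n : ℕ} {c η : ℝ} {ν : Measure (Matrix (Fin n) (Fin n) ℝ)}

theorem IsRegularLaw.integrable_apply (hν : IsRegularLaw c η ν) (i j : Fin n) :
    Integrable (fun b : Matrix (Fin n) (Fin n) ℝ => b i j) ν :=
  (hν.mean i j).1

theorem IsRegularLaw.integral_apply (hν : IsRegularLaw c η ν) (i j : Fin n) :
    ∫ b : Matrix (Fin n) (Fin n) ℝ, b i j ∂ν = (1 : Matrix (Fin n) (Fin n) ℝ) i j :=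
  (hν.mean i j).2

theorem trace_mul_eq_sum (V b : Matrix (Fin n) (Fin n) ℝ) :
    (V * b).trace = ∑ i, ∑ j, V i j * b j i := by
  simp [Matrix.trace, Matrix.mul_apply]

theorem IsRegularLaw.integrable_trace_mul (hν : IsRegularLaw c η ν)
    (V : Matrix (Fin n) (Fin n) ℝ) : Integrable (fun b => (V * b).trace) ν := by
  simp only [trace_mul_eq_sum]
  exact integrable_finsetSum _ fun i _ => integrable_finsetSum _ fun j _ =>
    (hν.integrable_apply j i).const_mul _

theorem IsRegularLaw.integral_trace_mul (hν : IsRegularLaw c η ν)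
    (V : Matrix (Fin n) (Fin n) ℝ) : ∫ b, (V * b).trace ∂ν = V.trace := by
  have hint : ∀ i j, Integrable (fun b : Matrix (Fin n) (Fin n) ℝ => V i j * b j i) ν :=
    fun i j => (hν.integrable_apply j i).const_mul _
  calc ∫ b, (V * b).trace ∂ν
      = ∫ b : Matrix (Fin n) (Fin n) ℝ, ∑ i, ∑ j, V i j * b j i ∂ν := by
        simp only [trace_mul_eq_sum]
    _ = ∑ i, ∑ j, ∫ b : Matrix (Fin n) (Fin n) ℝ, V i j * b j i ∂ν := by
        refine (integral_finsetSum _ fun i _ =>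
          integrable_finsetSum _ fun j _ => hint i j).trans ?_
        exact Finset.sum_congr rfl fun i _ => integral_finsetSum _ fun j _ => hint i j
    _ = (V * 1).trace := by
        simp only [integral_const_mul, hν.integral_apply, trace_mul_eq_sum]
    _ = V.trace := by rw [mul_one]

theorem continuous_norm_mul_mul (P : Matrix (Fin n) (Fin n) ℝ) :
    Continuous fun b : Matrix (Fin n) (Fin n) ℝ => ‖P * b * P‖ := by
  fun_prop

/-- Subtracting `c (|S| - 1)` normalizes all ranks to the same threshold: a level `s ≥ c` of the
shifted variable is a level at least `c |S|` of the norm, where (MSR) applies. Nonemptiness of `S`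
keeps the shift nonnegative. -/
theorem IsRegularLaw.hasExcessBound_norm_columnProj (hν : IsRegularLaw c η ν) (hc : 0 < c)
    (hη : 0 < η) {U : Matrix (Fin n) (Fin n) ℝ} (hU : U ∈ unitary (Matrix (Fin n) (Fin n) ℝ))
    {S : Finset (Fin n)} (hS : S.Nonempty) :
    HasExcessBound c η ν fun b =>
      ‖columnProj U S * b * columnProj U S‖ - c * ((S.card : ℝ) - 1) := by
  have := hν.isProbabilityMeasure
  refine hasExcessBound_of_tail
    ((continuous_norm_mul_mul _).measurable.sub_const _).aemeasurable hc hη fun s hs => ?_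
  have hs0 : 0 < s := hc.trans_le hs
  have hcard : (1 : ℝ) ≤ S.card := by exact_mod_cast hS.card_pos
  have hnn : 0 ≤ c * ((S.card : ℝ) - 1) := mul_nonneg hc.le (by linarith)
  have hrank : c * ((columnProj U S).rank : ℝ) ≤ s + c * ((S.card : ℝ) - 1) := by
    have : ((columnProj U S).rank : ℝ) ≤ S.card := by exact_mod_cast rank_columnProj_le U S
    nlinarith
  have h := hν.msr _ (isStarProjection_columnProj hU S) (s + c * ((S.card : ℝ) - 1))
    (by linarith) hrank
  calc _ = ν.real {b | s + c * ((S.card : ℝ) - 1) ≤ ‖columnProj U S * b * columnProj U S‖} := by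
        congr 1; ext b; simp [le_sub_iff_add_le]
    _ ≤ _ := h
    _ ≤ _ := by gcongr; linarith

/-- The spectral decomposition of `V` is an average of rank-one projections, for which the rank
shift vanishes. -/
theorem IsRegularLaw.hasExcessBound_trace_mul (hν : IsRegularLaw c η ν) (hc : 0 < c)
    (hη : 0 < η) {V : Matrix (Fin n) (Fin n) ℝ} (hV : 0 ≤ V) (htr : V.trace ≤ 1) :
    HasExcessBound c η ν fun b => (V * b).trace := by
  obtain ⟨U, hU, v, h⟩ :=
    (Matrix.nonneg_iff_posSemidef.mp hV).isHermitian.exists_unitary_diagonal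
  have h0 : ∀ i, 0 ≤ v i := by
    rwa [← zero_smul ℝ (1 : Matrix (Fin n) (Fin n) ℝ), Matrix.smul_one_eq_conj hU, h,
      Matrix.conj_diagonal_le_iff hU] at hV
  have hsum : ∑ i, v i ≤ 1 := by rwa [h, trace_conj_diagonal hU] at htr
  have hdec : V = ∑ i, v i • columnProj U {i} := by
    conv_lhs => rw [h]
    exact conj_diagonal_eq_sum_columnProj U v (fun i => {i}) v fun i => by simp
  refine HasExcessBound.of_le_average hc
    (Y := fun i b => ‖columnProj U {i} * b * columnProj U {i}‖) (w := v)
    (fun i => (continuous_norm_mul_mul _).measurable.aemeasurable) (fun i _ => ?_) h0 hsum ?_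
  · simpa using hν.hasExcessBound_norm_columnProj hc hη hU (Finset.singleton_nonempty i)
  · filter_upwards [hν.nonneg] with b hb
    have h1 : (V * b).trace ≤ ∑ i, v i * ‖columnProj U {i} * b * columnProj U {i}‖ := by
      rw [hdec, Finset.sum_mul, Matrix.trace_sum]
      refine Finset.sum_le_sum fun i _ => ?_
      rw [smul_mul_assoc, Matrix.trace_smul, smul_eq_mul]
      exact mul_le_mul_of_nonneg_left (Matrix.trace_columnProj_singleton_mul_le hU i hb) (h0 i)
    simp only [mul_sub, Finset.sum_sub_distrib, ← Finset.sum_mul]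
    nlinarith

/-- For `W ≥ 0`, the smallest `t` with `b W b ≤ t b` has the tail of an average of random
variables controlled by (MSR). -/
theorem IsRegularLaw.exists_form_bound (hν : IsRegularLaw c η ν) (hc : 0 < c) (hη : 0 < η)
    {W : Matrix (Fin n) (Fin n) ℝ} {m φ : ℝ} (hW : 0 ≤ W) (hm : 0 < m)
    (hWm : W ≤ m • (1 : Matrix (Fin n) (Fin n) ℝ)) (hφ : W.trace ≤ φ) :
    ∃ Q : Matrix (Fin n) (Fin n) ℝ → ℝ, Measurable Q ∧
      (∀ b, 0 ≤ b → ∀ t, Q b ≤ t → b * W * b ≤ t • b) ∧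
      ∀ a t, c ≤ a → a * (1 + 1 / η) ≤ c + (t - c * φ) / m →
        ν {b | t ≤ Q b} ≤ ENNReal.ofReal (c * a ^ (-(1 + η))) := by
  obtain ⟨U, hU, w, h⟩ :=
    (Matrix.nonneg_iff_posSemidef.mp hW).isHermitian.exists_unitary_diagonal
  have h0 : ∀ i, 0 ≤ w i := by
    rwa [← zero_smul ℝ (1 : Matrix (Fin n) (Fin n) ℝ), Matrix.smul_one_eq_conj hU, h,
      Matrix.conj_diagonal_le_iff hU] at hW
  have hwm : ∀ i, w i ≤ m := by
    rwa [h, Matrix.smul_one_eq_conj hU, Matrix.conj_diagonal_le_iff hU] at hWm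
  -- The layers write `W` as a sum of projections of total weight at most `m`, while the weighted
  -- sum of the ranks is `tr W`. The empty layer has weight zero, so only nonzero ranks are used.
  obtain ⟨μ, hμ0, hμe, hμm, hμw⟩ := exists_layers w m hm.le h0 hwm
  have hdec : W = ∑ S, μ S • columnProj U S := by
    conv_lhs => rw [h]
    exact conj_diagonal_eq_sum_columnProj U w (fun S => S) μ hμw
  have htr : W.trace = ∑ S, μ S * (S.card : ℝ) := by
    rw [h, trace_conj_diagonal hU, Finset.sum_congr rfl fun i _ => hμw i, Finset.sum_comm]
    refine Finset.sum_congr rfl fun S _ => ?_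
    simp [mul_comm]
  set Y : Finset (Fin n) → Matrix (Fin n) (Fin n) ℝ → ℝ :=
    fun S b => ‖columnProj U S * b * columnProj U S‖ with hY
  have hYm : ∀ S, Measurable (Y S) := fun S => (continuous_norm_mul_mul _).measurable
  refine ⟨fun b => ∑ S, μ S * Y S b,
    Finset.measurable_sum _ fun S _ => (hYm S).const_mul _, fun b hb t hQ => ?_,
    fun a t ha hat => ?_⟩
  · calc b * W * b = ∑ S, μ S • (b * columnProj U S * b) := by
          rw [hdec, Finset.mul_sum, Finset.sum_mul]
          simp
      _ ≤ ∑ S, μ S • (Y S b • b) := by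
          refine Finset.sum_le_sum fun S _ => smul_le_smul_of_nonneg_left ?_ (hμ0 S)
          exact Matrix.mul_proj_mul_le (isStarProjection_columnProj hU S) hb
      _ = (∑ S, μ S * Y S b) • b := by rw [Finset.sum_smul]; simp only [smul_smul]
      _ ≤ t • b := by gcongr
  -- Normalizing the weights by `m` and recentering each norm by its rank shift gives `Z = c + (Q -
  -- c tr W) / m`, so that `t ≤ Q` forces `Z ≥ c + (t - c φ) / m`.
  · set Z : Matrix (Fin n) (Fin n) ℝ → ℝ :=
      fun b => c + ∑ S, μ S / m * (Y S b - c * ((S.card : ℝ) - 1) - c) with hZ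
    have hZm : Measurable Z := measurable_const.add
      (Finset.measurable_sum _ fun S _ => (((hYm S).sub_const _).sub_const _).const_mul _)
    have hZex : HasExcessBound c η ν Z := by
      refine HasExcessBound.of_le_average hc
        (Y := fun S b => Y S b - c * ((S.card : ℝ) - 1)) (w := fun S => μ S / m)
        (fun S => ((hYm S).sub_const _).aemeasurable) (fun S hS => ?_)
        (fun S => div_nonneg (hμ0 S) hm.le) ?_ (Filter.Eventually.of_forall fun b => le_rfl)
      · refine hν.hasExcessBound_norm_columnProj hc hη hU ?_
        rw [Finset.nonempty_iff_ne_empty]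
        rintro rfl
        simp [hμe] at hS
      · rw [← Finset.sum_div]
        exact div_le_one_of_le₀ hμm hm.le
    refine (measure_mono fun b (hb : t ≤ ∑ S, μ S * Y S b) => ?_).trans
      (hZex.measure_le hZm.aemeasurable hc hη ha)
    show a * (1 + 1 / η) ≤ Z b
    have e : Z b = c + (∑ S, μ S * Y S b - c * W.trace) / m := by
      rw [hZ, htr, Finset.mul_sum, ← Finset.sum_sub_distrib, Finset.sum_div]
      simp only
      congr 1
      exact Finset.sum_congr rfl fun S _ => by ring
    rw [e]
    refine hat.trans ?_
    gcongr

end RegularLaw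

/-! ### One step at the upper edge. -/

section OneStep

open Matrix Set
open scoped MatrixOrder

variable {n : ℕ} {c η : ℝ} {ν : Measure (Matrix (Fin n) (Fin n) ℝ)}

theorem measurable_trace_mul (V : Matrix (Fin n) (Fin n) ℝ) :
    Measurable fun b : Matrix (Fin n) (Fin n) ℝ => (V * b).trace := by
  have : Continuous fun b : Matrix (Fin n) (Fin n) ℝ => (V * b).trace :=
    Continuous.matrix_trace (continuous_const.mul continuous_id)
  exact this.measurable

theorem Matrix.PosDef.trace_mul_self_pos {ι : Type*} [Fintype ι] [DecidableEq ι] [Nonempty ι]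
    {W : Matrix ι ι ℝ} (hW : W.PosDef) : 0 < (W * W).trace := by
  have h := hW.isHermitian.eq
  have h2 : (Wᴴ * W).PosDef :=
    Matrix.PosDef.conjTranspose_mul_self _ (Matrix.mulVec_injective_of_isUnit hW.isUnit)
  rw [h] at h2
  exact h2.trace_pos

/-- Tail of the smallest shift of the barrier that keeps the potential below `φ`. -/
theorem IsRegularLaw.measure_lt_softMax_sub_le [Nonempty (Fin n)] (hν : IsRegularLaw c η ν)
    (hc : 0 < c) (hη : 0 < η) {A : Matrix (Fin n) (Fin n) ℝ} {φ u t a r : ℝ}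
    (hφ : φ = t / (a * (1 + 1 / η))) (h : IsBarrier φ A u) (ht : 0 < t) (ht1 : t < 1)
    (ha : 2 * c ≤ a) (hr : 0 < r) :
    ν {b | r < softMax φ (A + b) - u} ≤
      ENNReal.ofReal (c * (a + t / (2 * (1 + 1 / η)) * r) ^ (-(1 + η))) +
      (ν {b | r < (((u • (1 : Matrix (Fin n) (Fin n) ℝ) - A)⁻¹ *
          (u • (1 : Matrix (Fin n) (Fin n) ℝ) - A)⁻¹) * b).trace /
          ((u • (1 : Matrix (Fin n) (Fin n) ℝ) - A)⁻¹ *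
          (u • (1 : Matrix (Fin n) (Fin n) ℝ) - A)⁻¹).trace / (1 - t) ^ 2} +
      (Ioi (a * (1 + 1 / η) / (1 - t))).indicator (fun r => ENNReal.ofReal
        (c * (0 + (1 - t) / (1 + 1 / η) * r) ^ (-(1 + η)))) r) := by
  have hD : 0 < 1 + 1 / η := by positivity
  have ha0 : 0 < a := by linarith
  have hφ0 : 0 < φ := by rw [hφ]; positivity
  have h1t : 0 < 1 - t := by linarith
  have htφ : t / φ = a * (1 + 1 / η) := by rw [hφ]; field_simp
  have hA := h.isHermitian
  obtain ⟨hX, htr⟩ := h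
  set X := u • (1 : Matrix (Fin n) (Fin n) ℝ) - A with hXdef
  have hM := hX.add_smul_one hr.le
  set M := X + r • (1 : Matrix (Fin n) (Fin n) ℝ) with hMdef
  have hXφ : φ⁻¹ • (1 : Matrix (Fin n) (Fin n) ℝ) ≤ X := by
    have := hX.smul_one_le htr (inv_nonneg.mpr hφ0.le) one_pos (inv_mul_cancel₀ hφ0.ne').le
    rwa [one_smul] at this
  have hW : 0 ≤ X⁻¹ := hX.inv.posSemidef.nonneg
  have hV : 0 ≤ M⁻¹ := hM.inv.posSemidef.nonneg
  have hXM : X ≤ M := by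
    rw [hMdef]
    exact le_add_of_nonneg_right (Matrix.PosSemidef.one.smul hr.le).nonneg
  have hVW : (M⁻¹).trace ≤ φ := (Matrix.trace_le_trace (hX.inv_antitone hXM)).trans htr
  -- the quadratic form controlled by (MSR)
  set m := (r + φ⁻¹)⁻¹ with hm
  have hm0 : 0 < m := by positivity
  have hVm : M⁻¹ ≤ m • (1 : Matrix (Fin n) (Fin n) ℝ) := by
    have h1 : (1 : Matrix (Fin n) (Fin n) ℝ) ≤ m • M := by
      calc (1 : Matrix (Fin n) (Fin n) ℝ) = m • ((r + φ⁻¹) • (1 : Matrix (Fin n) (Fin n) ℝ)) := by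
            rw [smul_smul, hm, inv_mul_cancel₀ (by positivity), one_smul]
        _ = m • (φ⁻¹ • (1 : Matrix (Fin n) (Fin n) ℝ) + r • (1 : Matrix (Fin n) (Fin n) ℝ)) := by
            module
        _ ≤ _ := by rw [hMdef]; gcongr
    have h2 := (Matrix.PosDef.one (n := Fin n) (R := ℝ)).inv_le_smul_inv hm0 h1
    rwa [inv_one] at h2
  obtain ⟨Q, -, hQ1, hQ2⟩ := hν.exists_form_bound hc hη hV hm0 hVm hVW
  have htailQ : ν {b | t ≤ Q b} ≤
      ENNReal.ofReal (c * (a + t / (2 * (1 + 1 / η)) * r) ^ (-(1 + η))) := by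
    -- Here `1/m = r + 1/φ`, so the available level is `t/φ + (t - c φ) r`. As `a ≥ 2c` gives `c φ ≤
    -- t/2`, it dominates `t/φ + t r / 2`, which is `1 + 1/η` times the chosen level.
    refine hQ2 _ _ ?_ ?_
    · have : 0 ≤ t / (2 * (1 + 1 / η)) * r := by positivity
      linarith
    · have e1 : (a + t / (2 * (1 + 1 / η)) * r) * (1 + 1 / η) = t / φ + t / 2 * r := by
        rw [htφ]; field_simp
      have e2 : c + (t - c * φ) / m = t / φ + (t - c * φ) * r := by
        rw [hm, div_inv_eq_mul, mul_add, sub_mul, sub_mul]; field_simp; ring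
      have e3 : c * φ ≤ t / 2 := by
        have hD1 : 1 ≤ 1 + 1 / η := by
          have : 0 < 1 / η := by positivity
          linarith
        have : φ * a ≤ t := by
          rw [hφ, div_mul_eq_mul_div, div_le_iff₀ (by positivity)]
          have : a ≤ a * (1 + 1 / η) := le_mul_of_one_le_right ha0.le hD1
          gcongr
        nlinarith
      rw [e1, e2]
      have : t / 2 ≤ t - c * φ := by linarith
      gcongr
  -- the linear form
  obtain ⟨hVV, hWV⟩ := hX.inv_mul_inv_add_le hr.le
  rw [← hMdef] at hVV hWV
  set p := (X⁻¹ * M⁻¹).trace with hp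
  have hp0 : 0 < p := (hM.inv.trace_mul_self_pos).trans_le (Matrix.trace_le_trace hVV)
  have hV2 : 0 ≤ M⁻¹ * M⁻¹ := by
    have := star_mul_self_nonneg M⁻¹
    rwa [(IsSelfAdjoint.of_nonneg hV).star_eq] at this
  have hlin : HasExcessBound c η ν fun b => ((p⁻¹ • (M⁻¹ * M⁻¹)) * b).trace := by
    refine hν.hasExcessBound_trace_mul hc hη (smul_nonneg (inv_nonneg.mpr hp0.le) hV2) ?_
    rw [Matrix.trace_smul, smul_eq_mul, inv_mul_le_iff₀ hp0, mul_one]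
    exact Matrix.trace_le_trace hVV
  -- if both forms are small then `u + r` is a barrier
  have hcover : ν {b | r < softMax φ (A + b) - u} ≤
      ν {b | t ≤ Q b} + ν {b | 0 ≤ b ∧ (1 - t) * r < ((p⁻¹ • (M⁻¹ * M⁻¹)) * b).trace} := by
    refine (measure_mono_ae ?_).trans (measure_union_le _ _)
    filter_upwards [hν.nonneg] with b hb (hlt : r < softMax φ (A + b) - u)
    by_contra hcon
    have hcon' : ¬ (t ≤ Q b ∨ (0 ≤ b ∧ (1 - t) * r < ((p⁻¹ • (M⁻¹ * M⁻¹)) * b).trace)) := hcon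
    push Not at hcon'
    obtain ⟨hQb, hZb⟩ := hcon'
    have hbM := Matrix.le_smul_of_mul_inv_mul_le ht hM.mul_inv_self hM.inv_mul_self hV
      hM.isHermitian (IsSelfAdjoint.of_nonneg hb) (hQ1 b hb t hQb.le)
    have hZ := hZb hb
    rw [smul_mul_assoc, Matrix.trace_smul, smul_eq_mul, inv_mul_le_iff₀ hp0] at hZ
    have hbar : IsBarrier φ (A + b) (u + r) := by
      refine IsBarrier.add_of_le ⟨hX, htr⟩ hr.le ht ht1 hb hbM ?_
      rw [Matrix.trace_mul_comm, ← mul_assoc]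
      calc _ ≤ _ := hZ
        _ = _ := by ring
    have hAb : (A + b).IsHermitian := hA.add (Matrix.nonneg_iff_posSemidef.mp hb).isHermitian
    linarith [softMax_le hAb hbar]
  refine hcover.trans (add_le_add htailQ ?_)
  -- The linear form depends on `r` through `M`. For large `r` its tail is enough. For `r ≤ a (1 +
  -- 1/η) / (1 - t)` the matrices `M` and `X` agree up to a factor `1/(1 - t)`, so it is compared
  -- with a form independent of `r`, whose mean is known exactly.
  by_cases hrR : a * (1 + 1 / η) / (1 - t) < r
  · rw [indicator_of_mem (show r ∈ Ioi _ from hrR)]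
    refine le_add_left ?_
    have hrR' : a ≤ 0 + (1 - t) / (1 + 1 / η) * r := by
      rw [zero_add, div_mul_eq_mul_div, le_div_iff₀ hD]
      rw [div_lt_iff₀ h1t] at hrR
      linarith
    refine (measure_mono fun b hb => ?_).trans
      (hlin.measure_le (measurable_trace_mul _).aemeasurable hc hη
        (a := 0 + (1 - t) / (1 + 1 / η) * r) (by linarith))
    have e : (0 + (1 - t) / (1 + 1 / η) * r) * (1 + 1 / η) = (1 - t) * r := by field_simp; ring
    show (0 + (1 - t) / (1 + 1 / η) * r) * (1 + 1 / η) ≤ _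
    rw [e]
    exact hb.2.le
  · refine le_add_right (measure_mono fun b hb => ?_)
    obtain ⟨hb0, hb⟩ := hb
    push Not at hrR
    have hq0 : 0 < (X⁻¹ * X⁻¹).trace := hX.inv.trace_mul_self_pos
    have hk : 0 < 1 + r * φ := by positivity
    have hMk : M ≤ (1 + r * φ) • X := by
      calc M = X + (r * φ) • φ⁻¹ • (1 : Matrix (Fin n) (Fin n) ℝ) := by
            rw [smul_smul, mul_assoc, mul_inv_cancel₀ hφ0.ne', mul_one]
        _ ≤ X + (r * φ) • X := by gcongr
        _ = _ := by module
    have h1 := Matrix.trace_mul_le_trace_mul (hM.inv_le_smul_inv hk hMk) hW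
    rw [smul_mul_assoc, Matrix.trace_smul, smul_eq_mul, Matrix.trace_mul_comm M⁻¹] at h1
    have h2 : (M⁻¹ * M⁻¹ * b).trace ≤ (X⁻¹ * X⁻¹ * b).trace :=
      Matrix.trace_mul_le_trace_mul (hVV.trans hWV) hb0
    have h3 : (1 + r * φ) * (1 - t) ≤ 1 := by
      have : r * φ ≤ t / (1 - t) := by
        rw [← htφ, div_div, le_div_iff₀ (by positivity)] at hrR
        rw [le_div_iff₀ h1t]
        linarith
      calc (1 + r * φ) * (1 - t) ≤ (1 + t / (1 - t)) * (1 - t) := by gcongr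
        _ = 1 := by field_simp; ring
    have h4 : (X⁻¹ * X⁻¹).trace * (1 - t) ≤ p := by
      calc (X⁻¹ * X⁻¹).trace * (1 - t) ≤ (1 + r * φ) * p * (1 - t) := by gcongr
        _ = ((1 + r * φ) * (1 - t)) * p := by ring
        _ ≤ 1 * p := by gcongr
        _ = p := one_mul p
    rw [smul_mul_assoc, Matrix.trace_smul, smul_eq_mul, lt_inv_mul_iff₀ hp0] at hb
    show r < _
    rw [div_div, lt_div_iff₀ (by positivity)]
    calc r * ((X⁻¹ * X⁻¹).trace * (1 - t) ^ 2)
        = ((X⁻¹ * X⁻¹).trace * (1 - t)) * ((1 - t) * r) := by ring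
      _ ≤ p * ((1 - t) * r) := by gcongr
      _ < _ := hb
      _ ≤ _ := h2

/-- Expected increase of the soft maximum of the spectrum when the random matrix is added. -/
theorem IsRegularLaw.lintegral_softMax_sub_le [Nonempty (Fin n)] (hν : IsRegularLaw c η ν)
    (hc : 0 < c) (hη : 0 < η) {A : Matrix (Fin n) (Fin n) ℝ} {φ u t a : ℝ}
    (hφ : φ = t / (a * (1 + 1 / η))) (h : IsBarrier φ A u) (ht : 0 < t) (ht1 : t < 1)
    (ha : 2 * c ≤ a) :
    ∫⁻ b, ENNReal.ofReal (softMax φ (A + b) - u) ∂ν ≤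
      ENNReal.ofReal (1 / (1 - t) ^ 2 + c * a ^ (-η) * (2 * (1 + 1 / η) / (t * η)
        + (1 + 1 / η) / ((1 - t) * η))) := by
  have hD : 0 < 1 + 1 / η := by positivity
  have ha0 : 0 < a := by linarith
  have hφ0 : 0 < φ := by rw [hφ]; positivity
  have h1t : 0 < 1 - t := by linarith
  set X := u • (1 : Matrix (Fin n) (Fin n) ℝ) - A with hXdef
  have hX : X.PosDef := h.1
  have hq0 : 0 < (X⁻¹ * X⁻¹).trace := hX.inv.trace_mul_self_pos
  have hW2 : 0 ≤ X⁻¹ * X⁻¹ := by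
    have := star_mul_self_nonneg X⁻¹
    rwa [IsSelfAdjoint.star_eq (x := X⁻¹) hX.inv.isHermitian] at this
  have hmeas : Measurable fun b => softMax φ (A + b) - u :=
    ((continuous_softMax hφ0).comp (continuous_const.add continuous_id)).measurable.sub_const _
  rw [lintegral_ofReal_eq_lintegral_meas_lt hmeas.aemeasurable]
  have hF1 : Measurable fun r : ℝ =>
      ENNReal.ofReal (c * (a + t / (2 * (1 + 1 / η)) * r) ^ (-(1 + η))) := by fun_prop
  have hF3 : Measurable ((Ioi (a * (1 + 1 / η) / (1 - t))).indicator (fun r : ℝ => ENNReal.ofReal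
        (c * (0 + (1 - t) / (1 + 1 / η) * r) ^ (-(1 + η))))) :=
    Measurable.indicator (by fun_prop) measurableSet_Ioi
  refine (setLIntegral_mono' measurableSet_Ioi fun r hr =>
    hν.measure_lt_softMax_sub_le hc hη hφ h ht ht1 ha hr).trans ?_
  rw [lintegral_add_left hF1, lintegral_add_right _ hF3]
  have hI1 := lintegral_Ioi_affine_rpow (c := c) (η := η) (p := a) (q := t / (2 * (1 + 1 / η)))
    (r₀ := 0) hc.le hη (by positivity) (by linarith)
  have hR0 : 0 ≤ a * (1 + 1 / η) / (1 - t) := by positivity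
  have hI3 := lintegral_Ioi_affine_rpow (c := c) (η := η) (p := 0) (q := (1 - t) / (1 + 1 / η))
    (r₀ := a * (1 + 1 / η) / (1 - t)) hc.le hη (by positivity) (by positivity)
  -- The main term: integrating the tail of the form independent of `r` over all `r > 0` returns its
  -- exact mean, since `𝔼 b = 1`. The other two integrals are errors of order `c a^(-η)`.
  have hI2 : ∫⁻ r in Ioi (0 : ℝ), ν {b | r < ((X⁻¹ * X⁻¹) * b).trace / (X⁻¹ * X⁻¹).trace
      / (1 - t) ^ 2} = ENNReal.ofReal (1 / (1 - t) ^ 2) := by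
    rw [← lintegral_ofReal_eq_lintegral_meas_lt
      (((measurable_trace_mul _).div_const _).div_const _).aemeasurable,
      ← ofReal_integral_eq_lintegral_ofReal
      (((hν.integrable_trace_mul _).div_const _).div_const _), integral_div, integral_div,
      hν.integral_trace_mul, div_self hq0.ne']
    filter_upwards [hν.nonneg] with b hb
    have := Matrix.trace_mul_nonneg_of_nonneg hW2 hb
    show 0 ≤ _
    positivity
  rw [hI1, hI2]
  have hI3' : ∫⁻ r in Ioi (0 : ℝ), (Ioi (a * (1 + 1 / η) / (1 - t))).indicator
      (fun r : ℝ => ENNReal.ofReal (c * (0 + (1 - t) / (1 + 1 / η) * r) ^ (-(1 + η)))) r ≤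
      ENNReal.ofReal (c * a ^ (-η) * ((1 + 1 / η) / ((1 - t) * η))) := by
    rw [setLIntegral_indicator measurableSet_Ioi, inter_eq_left.mpr (Ioi_subset_Ioi hR0), hI3]
    refine le_of_eq (congrArg _ ?_)
    have e : 0 + (1 - t) / (1 + 1 / η) * (a * (1 + 1 / η) / (1 - t)) = a := by field_simp; ring
    rw [e]
    field_simp
  refine (add_le_add_right (add_le_add_right hI3' _) _).trans_eq ?_
  rw [← ENNReal.ofReal_add (by positivity) (by positivity),
    ← ENNReal.ofReal_add (by positivity) (by positivity)]
  congr 1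
  rw [mul_zero, add_zero]
  field_simp
  ring

end OneStep

/-! ### One step at the lower edge. -/

section LowerStep

open Matrix Set
open scoped MatrixOrder

variable {n : ℕ} {c η : ℝ} {ν : Measure (Matrix (Fin n) (Fin n) ℝ)}

/-- When the random matrix `b` is subtracted, the soft maximum of the spectrum decreases by at
least a bounded random variable `δ` whose mean is close to `1`. -/
theorem IsRegularLaw.exists_decrease [Nonempty (Fin n)] (hν : IsRegularLaw c η ν)
    (hc : 0 < c) (hη : 0 < η) {A : Matrix (Fin n) (Fin n) ℝ} {φ u t a : ℝ}
    (hφ : φ = t / (a * (1 + 1 / η))) (h : IsBarrier φ A u) (ht : 0 < t) (ht1 : t < 1)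
    (ha : c ≤ a) :
    ∃ δ : Matrix (Fin n) (Fin n) ℝ → ℝ, Measurable δ ∧ (∀ b, 0 ≤ δ b) ∧
      (∀ b, δ b ≤ a * (1 + 1 / η)) ∧ (∀ b, 0 ≤ b → softMax φ (A - b) ≤ u - δ b) ∧
      (1 - t) ^ 2 * (1 - 2 * (c * (1 + 1 / η) * a ^ (-η))) ≤ ∫ b, δ b ∂ν ∧
      ∫ b, δ b ^ 2 ∂ν ≤ a * (1 + 1 / η) := by
  have := hν.isProbabilityMeasure
  have hD : 0 < 1 + 1 / η := by positivity
  have ha0 : 0 < a := by linarith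
  have hφ0 : 0 < φ := by rw [hφ]; positivity
  have h1t : 0 < 1 - t := by linarith
  have h1t2 : (1 - t) ^ 2 ≤ 1 := pow_le_one₀ h1t.le (by linarith)
  have htφ : t / φ = a * (1 + 1 / η) := by rw [hφ]; field_simp
  have hφa : a * (1 + 1 / η) * φ = t := by rw [hφ]; field_simp
  have hA := h.isHermitian
  have hX : (u • (1 : Matrix (Fin n) (Fin n) ℝ) - A).PosDef := h.1
  have htr : ((u • (1 : Matrix (Fin n) (Fin n) ℝ) - A)⁻¹).trace ≤ φ := h.2
  set X := u • (1 : Matrix (Fin n) (Fin n) ℝ) - A with hXdef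
  have hW : 0 ≤ X⁻¹ := hX.inv.posSemidef.nonneg
  obtain ⟨Q, hQm, hQ1, hQ2⟩ := hν.exists_form_bound hc hη hW hφ0
    ((Matrix.le_trace_smul_one hW).trans (by
      have := Matrix.PosSemidef.one.nonneg (n := Fin n) (𝕜 := ℝ)
      gcongr)) htr
  have hQt : ν {b | t ≤ Q b} ≤ ENNReal.ofReal (c * a ^ (-(1 + η))) := by
    refine hQ2 a t ha (le_of_eq ?_)
    rw [sub_div, mul_div_cancel_right₀ _ hφ0.ne', htφ]
    ring
  set q := (X⁻¹ * X⁻¹).trace with hq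
  have hq0 : 0 < q := hX.inv.trace_mul_self_pos
  set V := q⁻¹ • (X⁻¹ * X⁻¹) with hVdef
  have hV : 0 ≤ V := by
    have := star_mul_self_nonneg X⁻¹
    rw [(IsSelfAdjoint.of_nonneg hW).star_eq] at this
    exact smul_nonneg (inv_nonneg.mpr hq0.le) this
  have hVtr : V.trace = 1 := by
    rw [hVdef, Matrix.trace_smul, smul_eq_mul, inv_mul_cancel₀ hq0.ne']
  set Z : Matrix (Fin n) (Fin n) ℝ → ℝ := fun b => (V * b).trace with hZdef
  have hZm : Measurable Z := measurable_trace_mul V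
  have hZi : Integrable Z ν := hν.integrable_trace_mul V
  have hZ1 : ∫ b, Z b ∂ν = 1 := by rw [hν.integral_trace_mul, hVtr]
  have hZ0 : ∀ b, 0 ≤ b → 0 ≤ Z b := fun b hb => Matrix.trace_mul_nonneg_of_nonneg hV hb
  have hZex : HasExcessBound c η ν Z := hν.hasExcessBound_trace_mul hc hη hV hVtr.le
  -- The event on which the barrier may be lowered by `(1 - t)² Z`; elsewhere `δ = 0` and
  -- monotonicity suffices. The cap `Z < a (1 + 1/η) = t/φ` ensures both `δ φ ≤ t` and boundedness
  -- of `δ`; the condition `0 ≤ Z` makes `δ` nonnegative also at matrices that are not positive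
  -- semidefinite.
  set G : Set (Matrix (Fin n) (Fin n) ℝ) :=
    {b | Q b < t} ∩ ({b | 0 ≤ Z b} ∩ {b | Z b < a * (1 + 1 / η)}) with hGdef
  have hGm : MeasurableSet G := (measurableSet_lt hQm measurable_const).inter
    ((measurableSet_le measurable_const hZm).inter (measurableSet_lt hZm measurable_const))
  set δ : Matrix (Fin n) (Fin n) ℝ → ℝ := G.indicator fun b => (1 - t) ^ 2 * Z b with hδdef
  have hδm : Measurable δ := (hZm.const_mul _).indicator hGm
  have hδ0 : ∀ b, 0 ≤ δ b := fun b =>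
    indicator_nonneg (fun b hb => mul_nonneg (sq_nonneg _) hb.2.1) b
  have hδZ : ∀ b ∈ G, δ b ≤ Z b := fun b hb => by
    rw [hδdef, indicator_of_mem hb]
    exact mul_le_of_le_one_left hb.2.1 h1t2
  have hδa : ∀ b, δ b ≤ a * (1 + 1 / η) := fun b => by
    by_cases hb : b ∈ G
    · exact (hδZ b hb).trans hb.2.2.le
    · rw [hδdef, indicator_of_notMem hb]; positivity
  refine ⟨δ, hδm, hδ0, hδa, fun b hb => ?_, ?_, ?_⟩
  · have hAb : (A - b).IsHermitian := hA.sub (Matrix.nonneg_iff_posSemidef.mp hb).isHermitian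
    by_cases hbG : b ∈ G
    · refine softMax_le hAb ?_
      have hδb : δ b = (1 - t) ^ 2 * Z b := indicator_of_mem hbG _
      refine h.sub_of_le (hδ0 b) ht ht1 hb ?_ ?_ (le_of_eq ?_)
      · rw [← hφa]
        gcongr
        exact hδa b
      · exact Matrix.le_smul_of_mul_inv_mul_le ht hX.mul_inv_self hX.inv_mul_self hW
          hX.isHermitian (IsSelfAdjoint.of_nonneg hb) (hQ1 b hb t (le_of_lt hbG.1))
      · rw [hδb, Matrix.trace_mul_comm (X⁻¹ * b), ← mul_assoc]
        show (1 - t) ^ 2 * ((q⁻¹ • (X⁻¹ * X⁻¹)) * b).trace * q = _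
        rw [smul_mul_assoc, Matrix.trace_smul, smul_eq_mul]
        field_simp
        rfl
    · rw [hδdef, indicator_of_notMem hbG, sub_zero]
      exact (softMax_le_softMax hφ0 hAb hA (sub_le_self A hb)).trans (softMax_le hA h)
  · have e1 : ∫ b, δ b ∂ν = (1 - t) ^ 2 * ∫ b in G, Z b ∂ν := by
      rw [hδdef, integral_indicator hGm, integral_const_mul]
    have e2 := integral_add_compl hGm hZi
    have hae0 : 0 ≤ᵐ[ν.restrict Gᶜ] Z :=
      ae_restrict_of_ae (hν.nonneg.mono fun b hb => hZ0 b hb)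
    have e3 := ofReal_integral_eq_lintegral_ofReal hZi.restrict hae0
    -- Up to a null set, `G` fails only on two events of probability at most `c a^(-(1+η))`, and
    -- each costs at most `c (1 + 1/η) a^(-η)` of the mean of `Z`; hence the factor 2.
    have hsub : (Gᶜ : Set _) ≤ᵐ[ν] ({b | t ≤ Q b} ∪ {b | a * (1 + 1 / η) ≤ Z b} : Set _) := by
      filter_upwards [hν.nonneg] with b hb hbG
      by_contra hcon
      have hcon' : ¬ (t ≤ Q b ∨ a * (1 + 1 / η) ≤ Z b) := hcon
      push Not at hcon'
      exact hbG ⟨hcon'.1, hZ0 b hb, hcon'.2⟩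
    have e4 : ENNReal.ofReal (∫ b in Gᶜ, Z b ∂ν) ≤
        ENNReal.ofReal (2 * (c * (1 + 1 / η) * a ^ (-η))) := by
      rw [e3, two_mul, ENNReal.ofReal_add (by positivity) (by positivity)]
      calc ∫⁻ b in Gᶜ, ENNReal.ofReal (Z b) ∂ν
          ≤ ∫⁻ b in {b | t ≤ Q b} ∪ {b | a * (1 + 1 / η) ≤ Z b}, ENNReal.ofReal (Z b) ∂ν :=
            lintegral_mono_set' hsub
        _ ≤ _ := lintegral_union_le _ _ _
        _ ≤ _ := by
            gcongr
            · exact hZex.setLIntegral_le hc hη ha hQt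
            · exact hZex.setLIntegral_le hc hη ha (hZex.measure_le hZm.aemeasurable hc hη ha)
    have e5 := (ENNReal.ofReal_le_ofReal_iff (by positivity)).mp e4
    rw [e1]
    gcongr
    linarith
  · have hle : ∀ᵐ b ∂ν, δ b ^ 2 ≤ a * (1 + 1 / η) * Z b := by
      filter_upwards [hν.nonneg] with b hb
      have hZb := hZ0 b hb
      have hδb : δ b ≤ Z b := by
        by_cases hbG : b ∈ G
        · exact hδZ b hbG
        · rwa [hδdef, indicator_of_notMem hbG]
      rw [sq]
      exact mul_le_mul (hδa b) hδb (hδ0 b) (by positivity)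
    calc ∫ b, δ b ^ 2 ∂ν ≤ ∫ b, a * (1 + 1 / η) * Z b ∂ν :=
          integral_mono_of_nonneg (Filter.Eventually.of_forall fun b => sq_nonneg _)
            (hZi.const_mul _) hle
      _ = a * (1 + 1 / η) := by rw [integral_const_mul, hZ1, mul_one]

theorem sq_max_add_le (y d : ℝ) :
    (max (y + d) 0) ^ 2 ≤ (max y 0) ^ 2 + 2 * max y 0 * d + d ^ 2 := by
  rcases le_total y 0 with h | h
  · rw [max_eq_right h]
    rcases le_total (y + d) 0 with h' | h'
    · rw [max_eq_right h']; nlinarith [sq_nonneg d]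
    · rw [max_eq_left h']; nlinarith
  · rw [max_eq_left h]
    rcases le_total (y + d) 0 with h' | h'
    · rw [max_eq_right h']; nlinarith [sq_nonneg (y + d)]
    · rw [max_eq_left h']; nlinarith

/-- In the expansion of `(y + m - δ)₊²` the cross term `2 y₊ (m - 𝔼 δ)` is nonpositive, and `𝔼 (m -
δ)² ≤ 𝔼 δ² - m²`. The square therefore grows only additively, as for a supermartingale. -/
theorem IsRegularLaw.integral_sq_max_le [Nonempty (Fin n)] (hν : IsRegularLaw c η ν)
    (hc : 0 < c) (hη : 0 < η) {A : Matrix (Fin n) (Fin n) ℝ} {φ t a m : ℝ} (K : ℝ)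
    (hφ : φ = t / (a * (1 + 1 / η))) (hA : A.IsHermitian) (ht : 0 < t) (ht1 : t < 1)
    (ha : c ≤ a) (hm0 : 0 ≤ m)
    (hm : m = (1 - t) ^ 2 * (1 - 2 * (c * (1 + 1 / η) * a ^ (-η)))) :
    ∫ b, (max (K + m + softMax φ (A - b)) 0) ^ 2 ∂ν ≤
      (max (K + softMax φ A) 0) ^ 2 + a * (1 + 1 / η) := by
  have := hν.isProbabilityMeasure
  have ha0 : 0 < a := by linarith
  have hφ0 : 0 < φ := by rw [hφ]; positivity
  obtain ⟨δ, h1, h2, h3, h4, h5, h6⟩ :=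
    hν.exists_decrease hc hη hφ (isBarrier_softMax hφ0 hA) ht ht1 ha
  rw [← hm] at h5
  have hδi : Integrable δ ν := Integrable.of_bound h1.aestronglyMeasurable (a * (1 + 1 / η))
    (Filter.Eventually.of_forall fun b => by rw [Real.norm_of_nonneg (h2 b)]; exact h3 b)
  have hδ2i : Integrable (fun b => δ b ^ 2) ν :=
    Integrable.of_bound (h1.pow_const 2).aestronglyMeasurable ((a * (1 + 1 / η)) ^ 2)
    (Filter.Eventually.of_forall fun b => by
      rw [Real.norm_of_nonneg (sq_nonneg _)]
      have := h3 b
      have := h2 b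
      gcongr)
  set y := K + softMax φ A with hy
  have hpt : ∀ᵐ b ∂ν, (max (K + m + softMax φ (A - b)) 0) ^ 2 ≤
      ((max y 0) ^ 2 + 2 * max y 0 * m + m ^ 2) - (2 * max y 0 + 2 * m) * δ b + δ b ^ 2 := by
    filter_upwards [hν.nonneg] with b hb
    calc (max (K + m + softMax φ (A - b)) 0) ^ 2 ≤ (max (y + (m - δ b)) 0) ^ 2 := by
          have : K + m + softMax φ (A - b) ≤ y + (m - δ b) := by linarith [h4 b hb]
          gcongr
      _ ≤ _ := sq_max_add_le y (m - δ b)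
      _ = _ := by ring
  have hi1 : Integrable (fun b => ((max y 0) ^ 2 + 2 * max y 0 * m + m ^ 2)
      - (2 * max y 0 + 2 * m) * δ b) ν := (integrable_const _).sub (hδi.const_mul _)
  refine (integral_mono_of_nonneg (Filter.Eventually.of_forall fun b => sq_nonneg _)
    (hi1.add hδ2i) hpt).trans ?_
  have hsplit : ∫ b, (((max y 0) ^ 2 + 2 * max y 0 * m + m ^ 2)
      - (2 * max y 0 + 2 * m) * δ b + δ b ^ 2) ∂ν =
      ((max y 0) ^ 2 + 2 * max y 0 * m + m ^ 2) - (2 * max y 0 + 2 * m) * (∫ b, δ b ∂ν)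
        + ∫ b, δ b ^ 2 ∂ν := by
    rw [integral_add hi1 hδ2i, integral_sub (integrable_const _) (hδi.const_mul _),
      integral_const_mul]
    simp
  refine hsplit.trans_le ?_
  have hy0 : 0 ≤ max y 0 := le_max_right _ _
  have h7 : (2 * max y 0 + 2 * m) * m ≤ (2 * max y 0 + 2 * m) * ∫ b, δ b ∂ν := by gcongr
  nlinarith [sq_nonneg m]

theorem IsRegularLaw.integrable_norm (hν : IsRegularLaw c η ν) :
    Integrable (fun b : Matrix (Fin n) (Fin n) ℝ => ‖b‖) ν := by
  refine (hν.integrable_trace_mul 1).mono' continuous_norm.measurable.aestronglyMeasurable ?_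
  filter_upwards [hν.nonneg] with b hb
  have hbp := Matrix.nonneg_iff_posSemidef.mp hb
  rw [one_mul, norm_norm]
  refine hbp.isHermitian.norm_le_of_le hbp.trace_nonneg (Matrix.le_trace_smul_one hb) ?_
  exact (neg_nonpos.mpr hb).trans (smul_nonneg hbp.trace_nonneg Matrix.PosSemidef.one.nonneg)

theorem IsRegularLaw.integral_softMax_add_le [Nonempty (Fin n)] (hν : IsRegularLaw c η ν)
    (hc : 0 < c) (hη : 0 < η) {A : Matrix (Fin n) (Fin n) ℝ} {φ t a : ℝ}
    (hφ : φ = t / (a * (1 + 1 / η))) (hA : A.IsHermitian) (ht : 0 < t) (ht1 : t < 1)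
    (ha : 2 * c ≤ a) :
    ∫ b, softMax φ (A + b) ∂ν ≤ softMax φ A +
      (1 / (1 - t) ^ 2 + c * a ^ (-η) * (2 * (1 + 1 / η) / (t * η)
        + (1 + 1 / η) / ((1 - t) * η))) := by
  have := hν.isProbabilityMeasure
  have ha0 : 0 < a := by linarith
  have hφ0 : 0 < φ := by rw [hφ]; positivity
  have h1t : 0 < 1 - t := by linarith
  have hle := hν.lintegral_softMax_sub_le hc hη hφ (isBarrier_softMax hφ0 hA) ht ht1 ha
  have hmeas : Measurable fun b => softMax φ (A + b) :=
    ((continuous_softMax hφ0).comp (continuous_const.add continuous_id)).measurable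
  have hint : Integrable (fun b => softMax φ (A + b)) ν := by
    refine Integrable.mono' ((integrable_const (Fintype.card (Fin n) / φ + ‖A‖)).add
      hν.integrable_norm) hmeas.aestronglyMeasurable ?_
    filter_upwards [hν.nonneg] with b hb
    refine (abs_softMax_le hφ0
      (hA.add (Matrix.nonneg_iff_posSemidef.mp hb).isHermitian)).trans ?_
    show _ ≤ Fintype.card (Fin n) / φ + ‖A‖ + ‖b‖
    linarith [norm_add_le A b]
  have hsub : Integrable (fun b => softMax φ (A + b) - softMax φ A) ν :=
    hint.sub (integrable_const _)
  have h1 : ∫ b, (softMax φ (A + b) - softMax φ A) ∂ν ≤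
      (∫⁻ b, ENNReal.ofReal (softMax φ (A + b) - softMax φ A) ∂ν).toReal := by
    rw [integral_eq_lintegral_pos_part_sub_lintegral_neg_part hsub]
    exact sub_le_self _ ENNReal.toReal_nonneg
  have h2 := ENNReal.toReal_mono ENNReal.ofReal_ne_top hle
  rw [ENNReal.toReal_ofReal (by positivity)] at h2
  rw [integral_sub hint (integrable_const _), integral_const] at h1
  simp only [probReal_univ, one_smul] at h1
  linarith

end LowerStep

/-! ### Summing the one-step estimates over independent summands. -/

section Iteration

open Matrix Set
open scoped MatrixOrder

variable {n : ℕ} {c η : ℝ} {ν : Measure (Matrix (Fin n) (Fin n) ℝ)}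
  {Ω : Type*} [MeasurableSpace Ω] {μ : Measure Ω}

/-- Conditioning on `S` by Fubini: a one-step estimate for fixed `A = S ω` under the law of `T`
integrates to an estimate for `S + T`. -/
theorem integral_add_le_of_indepFun [IsProbabilityMeasure μ] {E : Type*} [MeasurableSpace E] [Add E] [MeasurableAdd₂ E]
    {S T : Ω → E} (hS : AEMeasurable S μ) (hT : AEMeasurable T μ) (hST : IndepFun S T μ)
    {F G : E → ℝ} (hFm : Measurable F)
    (hF : Integrable (fun ω => F (S ω + T ω)) μ) (hG : Integrable (fun ω => G (S ω)) μ)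
    (h : ∀ᵐ ω ∂μ, ∫ b, F (S ω + b) ∂(μ.map T) ≤ G (S ω)) :
    ∫ ω, F (S ω + T ω) ∂μ ≤ ∫ ω, G (S ω) ∂μ := by
  have hSP := Measure.isProbabilityMeasure_map hS
  have hTP := Measure.isProbabilityMeasure_map hT
  have hpair : AEMeasurable (fun ω => (S ω, T ω)) μ := hS.prodMk hT
  have hmap := (indepFun_iff_map_prod_eq_prod_map_map hS hT).mp hST
  have hFm2 : Measurable fun p : E × E => F (p.1 + p.2) :=
    hFm.comp (measurable_fst.add measurable_snd)
  have hFi : Integrable (fun p : E × E => F (p.1 + p.2)) ((μ.map S).prod (μ.map T)) := by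
    rw [← hmap]
    exact (integrable_map_measure hFm2.aestronglyMeasurable hpair).mpr hF
  have e1 : ∫ ω, F (S ω + T ω) ∂μ = ∫ a, ∫ b, F (a + b) ∂(μ.map T) ∂(μ.map S) := by
    rw [← integral_prod _ hFi, ← hmap, integral_map hpair hFm2.aestronglyMeasurable]
  have e2 := integral_map hS hFi.integral_prod_left.aestronglyMeasurable
  rw [e1, e2]
  have hi := (integrable_map_measure hFi.integral_prod_left.aestronglyMeasurable hS).mp
    hFi.integral_prod_left
  exact integral_mono_ae hi hG h

variable {κ : Type*} {Bs : κ → Ω → Matrix (Fin n) (Fin n) ℝ}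

theorem IsRegularLaw.ae_nonneg [Countable κ] (hν : IsRegularLaw c η ν) (hm : ∀ i, AEMeasurable (Bs i) μ)
    (hlaw : ∀ i, μ.map (Bs i) = ν) : ∀ᵐ ω ∂μ, ∀ s : Finset κ, 0 ≤ (∑ i ∈ s, Bs i) ω := by
  have h : ∀ᵐ ω ∂μ, ∀ i, 0 ≤ Bs i ω :=
    ae_all_iff.mpr fun i => ae_of_ae_map (hm i) ((hlaw i).symm ▸ hν.nonneg)
  filter_upwards [h] with ω hω s
  rw [Finset.sum_apply]
  exact Finset.sum_nonneg fun i _ => hω i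

theorem IsRegularLaw.integrable_norm_sum (hν : IsRegularLaw c η ν)
    (hm : ∀ i, AEMeasurable (Bs i) μ) (hlaw : ∀ i, μ.map (Bs i) = ν) (s : Finset κ) :
    Integrable (fun ω => ‖(∑ i ∈ s, Bs i) ω‖) μ := by
  have h1 : ∀ i, Integrable (fun ω => ‖Bs i ω‖) μ := fun i => by
    have := hν.integrable_norm
    rw [← hlaw i] at this
    exact (integrable_map_measure this.aestronglyMeasurable (hm i)).mp this
  refine (integrable_finsetSum s fun i _ => h1 i).mono'
    (continuous_norm.measurable.comp_aemeasurable
      (Finset.aemeasurable_sum s fun i _ => hm i)).aestronglyMeasurable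
    (Filter.Eventually.of_forall fun ω => ?_)
  rw [norm_norm, Finset.sum_apply]
  exact norm_sum_le _ _

variable [Countable κ] [IsProbabilityMeasure μ]

theorem IsRegularLaw.integrable_softMax_sum [Nonempty (Fin n)] (hν : IsRegularLaw c η ν)
    (hm : ∀ i, AEMeasurable (Bs i) μ) (hlaw : ∀ i, μ.map (Bs i) = ν) {φ : ℝ} (hφ : 0 < φ)
    (s : Finset κ) : Integrable (fun ω => softMax φ ((∑ i ∈ s, Bs i) ω)) μ := by
  refine ((integrable_const (Fintype.card (Fin n) / φ)).add
    (hν.integrable_norm_sum hm hlaw s)).mono'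
    ((continuous_softMax hφ).measurable.comp_aemeasurable
      (Finset.aemeasurable_sum s fun i _ => hm i)).aestronglyMeasurable ?_
  filter_upwards [hν.ae_nonneg hm hlaw] with ω hω
  exact abs_softMax_le hφ (Matrix.nonneg_iff_posSemidef.mp (hω s)).isHermitian

theorem IsRegularLaw.integral_softMax_sum_le [Nonempty (Fin n)] (hν : IsRegularLaw c η ν)
    (hc : 0 < c) (hη : 0 < η) {φ t a : ℝ} (hφ : φ = t / (a * (1 + 1 / η))) (ht : 0 < t)
    (ht1 : t < 1) (ha : 2 * c ≤ a) (hm : ∀ i, AEMeasurable (Bs i) μ)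
    (hlaw : ∀ i, μ.map (Bs i) = ν) (hindep : iIndepFun Bs μ) (s : Finset κ) :
    ∫ ω, softMax φ ((∑ i ∈ s, Bs i) ω) ∂μ ≤ n / φ + s.card *
      (1 / (1 - t) ^ 2 + c * a ^ (-η) * (2 * (1 + 1 / η) / (t * η)
        + (1 + 1 / η) / ((1 - t) * η))) := by
  classical
  have ha0 : 0 < a := by linarith
  have hφ0 : 0 < φ := by rw [hφ]; positivity
  set K := 1 / (1 - t) ^ 2 + c * a ^ (-η) * (2 * (1 + 1 / η) / (t * η)
        + (1 + 1 / η) / ((1 - t) * η)) with hK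
  induction s using Finset.induction_on with
  | empty => simpa using softMax_zero_le (ι := Fin n) hφ0
  | insert i s his ih =>
    have hS : AEMeasurable (∑ j ∈ s, Bs j) μ := Finset.aemeasurable_sum s fun j _ => hm j
    have hint := hν.integrable_softMax_sum hm hlaw hφ0
    have e : ∑ j ∈ insert i s, Bs j = ∑ j ∈ s, Bs j + Bs i := by
      rw [Finset.sum_insert his, add_comm]
    have hint' := hint (insert i s)
    rw [e] at hint' ⊢
    have hstep := integral_add_le_of_indepFun hS (hm i)
      (hindep.indepFun_finsetSum_of_notMem₀ hm his) (F := softMax φ)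
      (G := fun A => softMax φ A + K) (continuous_softMax hφ0).measurable hint' ((hint s).add (integrable_const _))
      (by
        rw [hlaw i]
        filter_upwards [hν.ae_nonneg hm hlaw] with ω hω
        exact hν.integral_softMax_add_le hc hη hφ
          (Matrix.nonneg_iff_posSemidef.mp (hω s)).isHermitian ht ht1 ha)
    rw [integral_add (hint s) (integrable_const _), integral_const] at hstep
    simp only [probReal_univ, one_smul] at hstep
    rw [Finset.card_insert_of_notMem his]
    push_cast
    refine hstep.trans ?_
    linarith

/-- The variable is essentially bounded: `-S ≤ 0` gives `softMax φ (-S) ≤ n / φ`. -/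
theorem IsRegularLaw.integrable_sq_max [Nonempty (Fin n)] (hν : IsRegularLaw c η ν)
    (hm : ∀ i, AEMeasurable (Bs i) μ) (hlaw : ∀ i, μ.map (Bs i) = ν) {φ : ℝ} (hφ : 0 < φ)
    (K : ℝ) (s : Finset κ) :
    Integrable (fun ω => (max (K + softMax φ (-(∑ i ∈ s, Bs i) ω)) 0) ^ 2) μ := by
  refine Integrable.of_bound ((((continuous_const.add ((continuous_softMax hφ).comp
      continuous_neg)).max continuous_const).pow 2).measurable.comp_aemeasurable
      (Finset.aemeasurable_sum s fun i _ => hm i)).aestronglyMeasurable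
      ((max (K + Fintype.card (Fin n) / φ) 0) ^ 2) ?_
  filter_upwards [hν.ae_nonneg hm hlaw] with ω hω
  rw [Real.norm_of_nonneg (sq_nonneg _)]
  have h1 : softMax φ (-(∑ i ∈ s, Bs i) ω) ≤ Fintype.card (Fin n) / φ :=
    (softMax_le_softMax hφ (Matrix.nonneg_iff_posSemidef.mp (hω s)).isHermitian.neg
      Matrix.isHermitian_zero (neg_nonpos.mpr (hω s))).trans (softMax_zero_le hφ)
  gcongr

/-- The offset `n / φ` cancels the initial value of `softMax`, so the recursion starts at `0`; each
summand then adds `a (1 + 1/η)`. -/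
theorem IsRegularLaw.integral_sq_max_sum_le [Nonempty (Fin n)] (hν : IsRegularLaw c η ν)
    (hc : 0 < c) (hη : 0 < η) {φ t a m : ℝ} (hφ : φ = t / (a * (1 + 1 / η))) (ht : 0 < t)
    (ht1 : t < 1) (ha : c ≤ a) (hm0 : 0 ≤ m)
    (hmdef : m = (1 - t) ^ 2 * (1 - 2 * (c * (1 + 1 / η) * a ^ (-η))))
    (hm : ∀ i, AEMeasurable (Bs i) μ)
    (hlaw : ∀ i, μ.map (Bs i) = ν) (hindep : iIndepFun Bs μ) (s : Finset κ) :
    ∫ ω, (max (s.card * m - n / φ + softMax φ (-(∑ i ∈ s, Bs i) ω)) 0) ^ 2 ∂μ ≤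
      s.card * (a * (1 + 1 / η)) := by
  classical
  have ha0 : 0 < a := by linarith
  have hφ0 : 0 < φ := by rw [hφ]; positivity
  induction s using Finset.induction_on with
  | empty =>
    have h0 := softMax_zero_le (ι := Fin n) hφ0
    rw [Fintype.card_fin] at h0
    have : max (-(n / φ) + softMax φ (0 : Matrix (Fin n) (Fin n) ℝ)) 0 = 0 :=
      max_eq_right (by linarith)
    simp [this]
  | insert i s his ih =>
    have hS : AEMeasurable (∑ j ∈ s, Bs j) μ := Finset.aemeasurable_sum s fun j _ => hm j
    have hint := fun K s => hν.integrable_sq_max hm hlaw hφ0 K s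
    have hmeas : ∀ K : ℝ, Measurable fun A : Matrix (Fin n) (Fin n) ℝ =>
        (max (K + softMax φ (-A)) 0) ^ 2 := fun K =>
      (((continuous_const.add ((continuous_softMax hφ0).comp
        continuous_neg)).max continuous_const).pow 2).measurable
    have e : ∑ j ∈ insert i s, Bs j = ∑ j ∈ s, Bs j + Bs i := by
      rw [Finset.sum_insert his, add_comm]
    rw [Finset.card_insert_of_notMem his]
    push_cast
    set K := (s.card : ℝ) * m - n / φ with hK
    have hKm : ((s.card : ℝ) + 1) * m - n / φ = K + m := by rw [hK]; ring
    rw [hKm]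
    have hint' := hint (K + m) (insert i s)
    rw [e] at hint' ⊢
    have hstep := integral_add_le_of_indepFun hS (hm i)
      (hindep.indepFun_finsetSum_of_notMem₀ hm his)
      (F := fun A => (max (K + m + softMax φ (-A)) 0) ^ 2)
      (G := fun A => (max (K + softMax φ (-A)) 0) ^ 2 + a * (1 + 1 / η)) (hmeas _) hint' ((hint K s).add (integrable_const _))
      (by
        rw [hlaw i]
        filter_upwards [hν.ae_nonneg hm hlaw] with ω hω
        simp only [neg_add, ← sub_eq_add_neg]
        exact hν.integral_sq_max_le hc hη K hφ
          (Matrix.nonneg_iff_posSemidef.mp (hω s)).isHermitian.neg ht ht1 ha hm0 hmdef)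
    rw [integral_add (hint K s) (integrable_const _), integral_const] at hstep
    simp only [probReal_univ, one_smul] at hstep
    refine hstep.trans ?_
    linarith

end Iteration

/-! ### The numerical constant dominates what the argument needs. -/

section SampleSize

open Set

variable {n : ℕ} {c η : ℝ} {ν : Measure (Matrix (Fin n) (Fin n) ℝ)}

/-- The variable `tr b / n` has mean `1`, so its mean excess over `1/2` is at least `1/2`; the
excess bound at level `1/2` then prevents `c` from being small compared with `η`. -/
theorem IsRegularLaw.div_four_le [Nonempty (Fin n)] (hν : IsRegularLaw c η ν) (hc : 0 < c)
    (hη : 0 < η) (hη1 : η < 1) (hc1 : c ≤ 1 / 2) : η / 4 ≤ c := by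
  have := hν.isProbabilityMeasure
  have hn : (0 : ℝ) < n := by
    have := Fintype.card_pos (α := Fin n)
    rw [Fintype.card_fin] at this
    exact_mod_cast this
  set V : Matrix (Fin n) (Fin n) ℝ := (n : ℝ)⁻¹ • 1 with hV
  have hVtr : V.trace = 1 := by
    rw [hV, Matrix.trace_smul, Matrix.trace_one, Fintype.card_fin, smul_eq_mul,
      inv_mul_cancel₀ hn.ne']
  have hV0 : V.PosSemidef := Matrix.PosSemidef.one.smul (inv_nonneg.mpr hn.le)
  have h1 := hν.hasExcessBound_trace_mul hc hη (Matrix.nonneg_iff_posSemidef.mpr hV0) hVtr.le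
    (1 / 2) hc1
  have hi : Integrable (fun b => (V * b).trace - 1 / 2) ν :=
    (hν.integrable_trace_mul V).sub (integrable_const _)
  have h2 : ∫ b, ((V * b).trace - 1 / 2) ∂ν = 1 / 2 := by
    rw [integral_sub (hν.integrable_trace_mul V) (integrable_const _), hν.integral_trace_mul,
      hVtr, integral_const]
    norm_num
  have h3 : ∫ b, ((V * b).trace - 1 / 2) ∂ν ≤
      (∫⁻ b, ENNReal.ofReal ((V * b).trace - 1 / 2) ∂ν).toReal := by
    rw [integral_eq_lintegral_pos_part_sub_lintegral_neg_part hi]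
    exact sub_le_self _ ENNReal.toReal_nonneg
  have h4 := ENNReal.toReal_mono ENNReal.ofReal_ne_top h1
  rw [ENNReal.toReal_ofReal (by positivity)] at h4
  have h5 : (1 / 2 : ℝ) ^ (-η) ≤ 2 := by
    rw [Real.rpow_neg (by norm_num), ← Real.inv_rpow (by norm_num)]
    norm_num
    calc (2 : ℝ) ^ η ≤ 2 ^ (1 : ℝ) := Real.rpow_le_rpow_of_exponent_le (by norm_num) hη1.le
      _ = 2 := Real.rpow_one 2
  have h6 : 1 / 2 ≤ c * 2 / η := by
    calc (1 / 2 : ℝ) ≤ _ := h2.symm.le.trans (h3.trans h4)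
      _ ≤ c * 2 / η := by gcongr
  rw [le_div_iff₀ hη] at h6
  linarith

/-- Covers the case where the truncation level is determined by `ε`. -/
theorem mul_le_covConst_of_rpow (hc : 0 < c) (hη : 0 < η) :
    256 * (1 + 1 / η) * (256 * c * (1 + 1 / η) ^ 2) ^ (1 / η) ≤ covConst c η := by
  have hD1 : 1 ≤ 1 + 1 / η := by
    have : 0 < 1 / η := by positivity
    linarith
  refine le_trans ?_ ((le_max_right _ _).trans (le_max_left _ _))
  set D := 1 + 1 / η with hD
  have e1 : 32 + 32 / η = 32 * D := by rw [hD]; ring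
  have e2 : (32 * D) ^ (1 + 3 / η) = 32 * D * ((32 * D) ^ 3) ^ (1 / η) := by
    rw [Real.rpow_add (by positivity), Real.rpow_one, ← Real.rpow_natCast, ← Real.rpow_mul
      (by positivity)]
    congr 2
    push_cast
    ring
  rw [e1, e2]
  have h1 : (256 * c * D ^ 2) ^ (1 / η) ≤ (4 * c * (32 * D) ^ 3) ^ (1 / η) := by
    refine Real.rpow_le_rpow (by positivity) ?_ (by positivity)
    have : D ^ 2 ≤ D ^ 3 := pow_le_pow_right₀ hD1 (by norm_num)
    nlinarith
  rw [Real.mul_rpow (x := 4 * c) (by positivity) (by positivity)] at h1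
  calc 256 * D * (256 * c * D ^ 2) ^ (1 / η)
      ≤ 2048 * D * ((4 * c) ^ (1 / η) * ((32 * D) ^ 3) ^ (1 / η)) := by gcongr; norm_num
    _ = _ := by ring

/-- Covers the case where the truncation level is `2c`. The third member of the maximum suffices for
`c ≥ 4`, the second for `c ≤ 4`; the hypothesis `h` excludes small `c` when `η < 1`. -/
theorem mul_le_covConst (hc : 0 < c) (hη : 0 < η) (h : η < 1 → c ≤ 1 / 2 → η / 4 ≤ c) :
    512 * (1 + 1 / η) * c ≤ covConst c η := by
  have hη' : 0 < 1 / η := by positivity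
  have hD1 : 1 ≤ 1 + 1 / η := by linarith
  have hDη : (1 + 1 / η) * η = η + 1 := by field_simp
  set D := 1 + 1 / η with hD
  rcases le_total 4 c with hc4 | hc4
  · refine le_trans ?_ (le_max_right _ _)
    have e1 : 16 + 16 / η = 16 * D := by rw [hD]; ring
    have h1 : 4 * c ≤ (2 * c) ^ (3 / 2 + 2 / η) := by
      have h2 : (2 : ℝ) ≤ (2 * c) ^ (1 / 2 : ℝ) := by
        rw [← Real.sqrt_eq_rpow]
        exact Real.le_sqrt_of_sq_le (by linarith)
      calc 4 * c = 2 * c * 2 := by ring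
        _ ≤ 2 * c * (2 * c) ^ (1 / 2 : ℝ) := by gcongr
        _ = (2 * c) ^ (1 + 1 / 2 : ℝ) := by
            rw [Real.rpow_add (by positivity), Real.rpow_one]
        _ ≤ _ := by
            refine Real.rpow_le_rpow_of_exponent_le (by linarith) ?_
            have : 0 < 2 / η := by positivity
            linarith
    have h3 : D / 2 ≤ (16 * D) ^ (4 / η) := by
      rcases le_total 1 η with h1η | h1η
      · have : D ≤ 2 := by
          have : 1 / η ≤ 1 := by rw [div_le_one hη]; exact h1η
          linarith
        calc D / 2 ≤ 1 := by linarith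
          _ ≤ _ := Real.one_le_rpow (by linarith) (by positivity)
      · calc D / 2 ≤ (16 * D) ^ (1 : ℝ) := by rw [Real.rpow_one]; linarith
          _ ≤ _ := by
            refine Real.rpow_le_rpow_of_exponent_le (by linarith) ?_
            rw [le_div_iff₀ hη]; linarith
    rw [e1]
    calc 512 * D * c = 256 * (4 * c) * (D / 2) := by ring
      _ ≤ _ := by gcongr
  · refine le_trans ?_ ((le_max_right _ _).trans (le_max_left _ _))
    have e1 : 32 + 32 / η = 32 * D := by rw [hD]; ring
    have e2 : (32 * D) ^ (1 + 3 / η) = 32 * D * ((32 * D) ^ 3) ^ (1 / η) := by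
      rw [Real.rpow_add (by positivity), Real.rpow_one, ← Real.rpow_natCast, ← Real.rpow_mul
        (by positivity)]
      congr 2
      push_cast
      ring
    rw [e1, e2]
    set x := 4 * c * (32 * D) ^ 3 with hx
    have hx0 : 0 < x := by positivity
    have hD3 : D ≤ D ^ 3 := le_self_pow₀ hD1 (by norm_num)
    have hxD : 131072 * (c * D) ≤ x := by
      have : c * D ≤ c * D ^ 3 := by gcongr
      rw [hx]; nlinarith
    have hxc : c / 4 ≤ x ^ (1 / η) := by
      rcases le_total 1 x with h1 | h1
      · calc c / 4 ≤ 1 := by linarith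
          _ ≤ _ := Real.one_le_rpow h1 hη'.le
      · have hcD : c ≤ c * D := le_mul_of_one_le_right hc.le hD1
        rcases le_or_gt 1 η with h1η | h1η
        · calc c / 4 ≤ x := by linarith
            _ = x ^ (1 : ℝ) := (Real.rpow_one x).symm
            _ ≤ _ := Real.rpow_le_rpow_of_exponent_ge hx0 h1 (by
                rw [div_le_one hη]; exact h1η)
        -- Here `x ≥ 131072 c D` with `c ≥ η/4` and `D η = η + 1`, which contradicts `x ≤ 1`.
        · exfalso
          have h2 := h h1η (by linarith)
          have : η / 4 * D ≤ c * D := by gcongr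
          nlinarith
    have h4 : (4 * c) ^ (1 / η) * ((32 * D) ^ 3) ^ (1 / η) = x ^ (1 / η) := by
      rw [hx, Real.mul_rpow (x := 4 * c) (by positivity) (by positivity)]
    calc 512 * D * c = 2048 * D * (c / 4) := by ring
      _ ≤ 2048 * D * x ^ (1 / η) := by gcongr
      _ = _ := by rw [← h4]; ring

end SampleSize

/-! ### Choice of parameters and conclusion. -/

section Assembly

open Matrix Set
open scoped MatrixOrder

variable {n : ℕ} {c η : ℝ} {ν : Measure (Matrix (Fin n) (Fin n) ℝ)}

/-- Write `x`, `z` for the soft maxima of `S` and `-S`. The norm is at most the larger of `x/N - 1`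
and `1 + z/N`. As `x + z ≥ 0`, one has `x/N - 1 ≥ -β`, so `x/N - 1 + 2β` dominates both. Thus `x`
enters linearly and its mean suffices. -/
theorem norm_smul_sub_one_le [Nonempty (Fin n)] {S : Matrix (Fin n) (Fin n) ℝ}
    (hS : S.IsHermitian) {φ N β : ℝ} (hφ : 0 < φ) (hN : 0 < N)
    (hβ : 1 + softMax φ (-S) / N ≤ β) (hβ0 : 0 ≤ β) :
    ‖(1 / N) • S - 1‖ ≤ softMax φ S / N - 1 + 2 * β := by
  have h1 := le_softMax_smul_one hφ hS
  have h2 := le_softMax_smul_one hφ hS.neg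
  set x := softMax φ S
  set z := softMax φ (-S)
  have hxz : 0 ≤ x + z := by
    have h3 := add_le_add h1 h2
    rw [add_neg_cancel, ← add_smul, ← zero_smul ℝ (1 : Matrix (Fin n) (Fin n) ℝ),
      Matrix.smul_one_le_smul_one_iff] at h3
    exact h3
  have hxz' : 0 ≤ x / N + z / N := by rw [← add_div]; positivity
  have hone : (0 : Matrix (Fin n) (Fin n) ℝ) ≤ 1 := Matrix.PosSemidef.one.nonneg
  have hN' : 0 ≤ 1 / N := by positivity
  refine Matrix.IsHermitian.norm_le_of_le
    ((IsSelfAdjoint.smul (IsSelfAdjoint.all _) hS).sub (IsSelfAdjoint.one _)) (by linarith) ?_ ?_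
  · calc (1 / N) • S - 1 ≤ (1 / N) • (x • (1 : Matrix (Fin n) (Fin n) ℝ)) - 1 := by gcongr
      _ = (x / N - 1) • (1 : Matrix (Fin n) (Fin n) ℝ) := by
          rw [smul_smul, sub_smul, one_smul, one_div_mul_eq_div]
      _ ≤ _ := smul_le_smul_of_nonneg_right (by linarith) hone
  · calc -((1 / N) • S - 1) = 1 + (1 / N) • (-S) := by rw [smul_neg]; abel
      _ ≤ 1 + (1 / N) • (z • (1 : Matrix (Fin n) (Fin n) ℝ)) := by gcongr
      _ = (1 + z / N) • (1 : Matrix (Fin n) (Fin n) ℝ) := by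
          rw [smul_smul, add_smul, one_smul, one_div_mul_eq_div]
      _ ≤ _ := smul_le_smul_of_nonneg_right (by linarith) hone

theorem lower_drift_bounds {ε x m : ℝ} (hε : 0 < ε) (hε1 : ε < 1) (hx0 : 0 ≤ x)
    (hx : x ≤ ε ^ 2 / 256) (hm : m = (1 - ε / 32) ^ 2 * (1 - 2 * x)) :
    0 ≤ m ∧ m ≤ 1 ∧ 1 - m ≤ ε / 16 + ε / 128 := by
  have hε2 : ε ^ 2 ≤ ε := by nlinarith
  have h1 : (1 - ε / 32) ^ 2 ≤ 1 := pow_le_one₀ (by linarith) (by linarith)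
  have h2 : 0 ≤ (1 - ε / 32) ^ 2 := sq_nonneg _
  have h3 : (1 - ε / 32) ^ 2 * x ≤ x := mul_le_of_le_one_left hx0 h1
  have h4 : 0 ≤ (1 - ε / 32) ^ 2 * x := mul_nonneg h2 hx0
  have h5 : m = (1 - ε / 32) ^ 2 - 2 * ((1 - ε / 32) ^ 2 * x) := by rw [hm]; ring
  have h6 : 1 - ε / 16 ≤ (1 - ε / 32) ^ 2 := by nlinarith [sq_nonneg ε]
  refine ⟨?_, ?_, ?_⟩ <;> linarith

theorem upper_drift_bound {ε D w t : ℝ} (hη : 0 < η) (hε : 0 < ε) (hε1 : ε < 1)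
    (hηD : 1 / η ≤ D) (hw0 : 0 ≤ w) (hw : w * D ^ 2 ≤ ε ^ 2 / 256) (ht : t = ε / 32) :
    1 / (1 - t) ^ 2 + w * (2 * D / (t * η) + D / ((1 - t) * η)) ≤
      1 + 2.2 * t + ε / 4 + ε / 64 := by
  have hε2 : ε ^ 2 ≤ ε := by nlinarith
  have ht0 : 0 < t := by rw [ht]; positivity
  have ht1 : t ≤ 1 / 32 := by rw [ht]; linarith
  have hD0 : 0 < D := lt_of_lt_of_le (by positivity) hηD
  have h1 : 1 / (1 - t) ^ 2 ≤ 1 + 2.2 * t := by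
    rw [div_le_iff₀ (pow_pos (by linarith) 2)]
    have : t ^ 2 ≤ t / 32 := by nlinarith
    have : 0 < t ^ 3 := by positivity
    nlinarith
  have hDη : w * (D * (1 / η)) ≤ ε ^ 2 / 256 := by
    refine le_trans ?_ hw
    rw [sq]
    gcongr
  have h2 : w * (2 * D / (t * η)) ≤ ε / 4 := by
    calc w * (2 * D / (t * η)) = 2 / t * (w * (D * (1 / η))) := by field_simp
      _ ≤ 2 / t * (ε ^ 2 / 256) := by gcongr
      _ = ε / 4 := by rw [ht]; field_simp; norm_num
  have h3 : w * (D / ((1 - t) * η)) ≤ ε / 64 := by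
    have h4 : 1 / (1 - t) ≤ 2 := by
      rw [div_le_iff₀ (by linarith)]; linarith
    calc w * (D / ((1 - t) * η)) = 1 / (1 - t) * (w * (D * (1 / η))) := by
          have : 1 - t ≠ 0 := by linarith
          field_simp
      _ ≤ 2 * (ε ^ 2 / 256) := by
          have : 0 ≤ w * (D * (1 / η)) := by positivity
          gcongr
      _ ≤ ε / 64 := by linarith
  rw [mul_add]
  linarith

/-- `haη` makes the truncation errors small at both edges, and `hN` makes both the initial cost
`n/φ` and the fluctuations of the lower edge small compared with `N`. -/
theorem IsRegularLaw.integral_norm_le [Nonempty (Fin n)] (hν : IsRegularLaw c η ν)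
    (hc : 0 < c) (hη : 0 < η) {ε a : ℝ} (hε : 0 < ε) (hε1 : ε < 1) (ha : 2 * c ≤ a)
    (haη : c * a ^ (-η) * (1 + 1 / η) ^ 2 ≤ ε ^ 2 / 256) {N : ℕ}
    (hN : 256 * n * (a * (1 + 1 / η)) ≤ N * ε ^ 2)
    {Ω : Type*} [MeasurableSpace Ω] {μ : Measure Ω} [IsProbabilityMeasure μ]
    {Bs : Fin N → Ω → Matrix (Fin n) (Fin n) ℝ} (hm : ∀ i, AEMeasurable (Bs i) μ)
    (hlaw : ∀ i, μ.map (Bs i) = ν) (hindep : iIndepFun Bs μ) :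
    ∫ ω, ‖((1 / (N : ℝ)) • (∑ i, Bs i ω)) - (1 : Matrix (Fin n) (Fin n) ℝ)‖ ∂μ ≤ ε := by
  have hn : (1 : ℝ) ≤ n := by
    have := Fintype.card_pos (α := Fin n)
    rw [Fintype.card_fin] at this
    exact_mod_cast this
  have hη' : 0 < 1 / η := by positivity
  have hD1 : 1 ≤ 1 + 1 / η := by linarith
  set D := 1 + 1 / η with hD
  have ha0 : 0 < a := by linarith
  have haD : 0 < a * D := by positivity
  have hN0 : (0 : ℝ) < N := by
    have : 0 < (N : ℝ) * ε ^ 2 := lt_of_lt_of_le (by positivity) hN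
    exact pos_of_mul_pos_left this (by positivity)
  set t := ε / 32 with ht
  have ht0 : 0 < t := by positivity
  have ht1 : t < 1 := by linarith
  set φ := t / (a * D) with hφ
  have hφ0 : 0 < φ := by positivity
  set w := c * a ^ (-η) with hw
  have hw0 : 0 ≤ w := by positivity
  have hwD : w * D ≤ ε ^ 2 / 256 := by
    refine le_trans ?_ haη
    have : D ≤ D ^ 2 := le_self_pow₀ hD1 (by norm_num)
    gcongr
  set m := (1 - t) ^ 2 * (1 - 2 * (c * D * a ^ (-η))) with hmdef
  have hcD : c * D * a ^ (-η) = w * D := by rw [hw]; ring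
  obtain ⟨hm0, hm1', hm1⟩ := lower_drift_bounds hε hε1 (by positivity) hwD
    (hmdef.trans (by rw [hcD]))
  set K := 1 / (1 - t) ^ 2 + w * (2 * D / (t * η) + D / ((1 - t) * η)) with hK
  have hKle : K ≤ 1 + 2.2 * t + ε / 4 + ε / 64 :=
    upper_drift_bound hη hε hε1 (by linarith) hw0 haη ht
  set ρ := (n : ℝ) / φ / N with hρ
  have hρ0 : 0 ≤ ρ := by positivity
  have hρle : ρ ≤ ε / 8 := by
    rw [hρ, div_le_iff₀ hN0, hφ, div_div_eq_mul_div, div_le_iff₀ ht0, ht]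
    linarith
  -- The balancing scale in `2y ≤ y²/g + g`: `𝔼 y² ≤ N a D ≤ g²`, so after division by `N` each of
  -- the two terms costs at most `ε/16` on average.
  set g := ε / 16 * N with hg
  have hg0 : 0 < g := by positivity
  have hNg : N * (a * D) ≤ g * g := by
    have h1 : 256 * (a * D) ≤ N * ε ^ 2 := by
      refine le_trans ?_ hN
      gcongr
      linarith
    calc (N : ℝ) * (a * D) ≤ N * (N * ε ^ 2 / 256) := by gcongr; linarith
      _ = g * g := by rw [hg]; ring
  set S : Ω → Matrix (Fin n) (Fin n) ℝ := ∑ i, Bs i with hS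
  have hSum : ∀ ω, ∑ i, Bs i ω = S ω := fun ω => by rw [hS, Finset.sum_apply]
  set y : Ω → ℝ := fun ω => max (N * m - n / φ + softMax φ (-S ω)) 0 with hy
  have hUi := hν.integrable_softMax_sum hm hlaw hφ0 Finset.univ
  have hUle := hν.integral_softMax_sum_le hc hη hφ ht0 ht1 ha hm hlaw hindep Finset.univ
  have hYi := hν.integrable_sq_max hm hlaw hφ0 (N * m - n / φ) Finset.univ
  have hYle := hν.integral_sq_max_sum_le hc hη hφ ht0 ht1 (by linarith) hm0 hmdef hm hlaw hindep
    Finset.univ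
  rw [Finset.card_univ, Fintype.card_fin] at hUle hYle
  rw [← hS] at hUi hUle hYi hYle
  change Integrable (fun ω => y ω ^ 2) μ at hYi
  change ∫ ω, y ω ^ 2 ∂μ ≤ N * (a * D) at hYle
  change ∫ ω, softMax φ (S ω) ∂μ ≤ n / φ + N * K at hUle
  have hpt : ∀ᵐ ω ∂μ, ‖((1 / (N : ℝ)) • (∑ i, Bs i ω)) - (1 : Matrix (Fin n) (Fin n) ℝ)‖ ≤
      softMax φ (S ω) / N + y ω ^ 2 * (1 / (N * g)) + (-1 + 2 * (1 - m + ρ) + g / N) := by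
    filter_upwards [hν.ae_nonneg hm hlaw] with ω hω
    have hSω : 0 ≤ S ω := hω Finset.univ
    have hy0 : 0 ≤ y ω := le_max_right _ _
    have hz : softMax φ (-S ω) ≤ y ω - N * m + n / φ := by
      have : N * m - n / φ + softMax φ (-S ω) ≤ y ω := le_max_left _ _
      linarith
    rw [hSum]
    refine (norm_smul_sub_one_le (Matrix.nonneg_iff_posSemidef.mp hSω).isHermitian hφ0 hN0
      (β := 1 - m + ρ + y ω / N) ?_ ?_).trans ?_
    · have : softMax φ (-S ω) / N ≤ (y ω - N * m + n / φ) / N := by gcongr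
      have e : (y ω - N * m + n / φ) / N = y ω / N - m + ρ := by
        rw [hρ, add_div, sub_div, mul_div_cancel_left₀ _ hN0.ne']
      linarith
    · have : 0 ≤ y ω / N := by positivity
      linarith
    · have h1 : 2 * (y ω / N) ≤ y ω ^ 2 * (1 / (N * g)) + g / N := by
        have e : y ω ^ 2 * (1 / (N * g)) + g / N - 2 * (y ω / N) = (y ω - g) ^ 2 / (N * g) := by
          field_simp; ring
        have : 0 ≤ (y ω - g) ^ 2 / (N * g) := by positivity
        linarith
      linarith
  have hi1 : Integrable (fun ω => softMax φ (S ω) / N + y ω ^ 2 * (1 / (N * g))) μ :=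
    (hUi.div_const _).add (hYi.mul_const _)
  refine (integral_mono_of_nonneg (Filter.Eventually.of_forall fun ω => norm_nonneg _)
    (hi1.add (integrable_const _)) hpt).trans ?_
  have e1 : ∫ ω, (softMax φ (S ω) / N + y ω ^ 2 * (1 / (N * g))
      + (-1 + 2 * (1 - m + ρ) + g / N)) ∂μ =
      (∫ ω, softMax φ (S ω) ∂μ) / N + (∫ ω, y ω ^ 2 ∂μ) * (1 / (N * g))
      + (-1 + 2 * (1 - m + ρ) + g / N) := by
    rw [integral_add hi1 (integrable_const _), integral_add (hUi.div_const _) (hYi.mul_const _),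
      integral_div, integral_mul_const]
    simp
  refine e1.trans_le ?_
  have h1 : (∫ ω, softMax φ (S ω) ∂μ) / N ≤ ρ + K := by
    rw [div_le_iff₀ hN0]
    refine hUle.trans_eq ?_
    rw [hρ]; field_simp
  have h2 : (∫ ω, y ω ^ 2 ∂μ) * (1 / (N * g)) ≤ ε / 16 := by
    rw [mul_one_div, div_le_iff₀ (by positivity)]
    refine hYle.trans (hNg.trans_eq ?_)
    rw [hg]; ring
  have h3 : g / N = ε / 16 := by rw [hg]; field_simp
  rw [h3]
  -- Budget in units of `ε`: `3/8` from `3ρ`, at most `2.2/32 + 1/4 + 1/64` from `K - 1`, at most `2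
  -- (1/16 + 1/128)` from `2 (1 - m)`, and `2/16` from `g`; the total is `0.975`.
  linarith

theorem measurableSet_setOf_nonneg (n : ℕ) :
    MeasurableSet {b : Matrix (Fin n) (Fin n) ℝ | 0 ≤ b} := by
  have e : {b : Matrix (Fin n) (Fin n) ℝ | 0 ≤ b} =
      {b | bᴴ = b} ∩ ⋂ x : Fin n → ℝ, {b | 0 ≤ star x ⬝ᵥ (b *ᵥ x)} := by
    ext b
    simp only [mem_ofPred_eq, mem_inter_iff, mem_iInter, Matrix.nonneg_iff_posSemidef,
      Matrix.posSemidef_iff_dotProduct_mulVec]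
    rfl
  rw [e]
  refine (IsClosed.inter (isClosed_eq continuous_star continuous_id)
    (isClosed_iInter fun x => isClosed_le continuous_const ?_)).measurableSet
  exact continuous_const.dotProduct (continuous_id.matrix_mulVec continuous_const)

theorem isRegularLaw_map {Ω₀ : Type*} [MeasurableSpace Ω₀] {μ₀ : Measure Ω₀}
    [IsProbabilityMeasure μ₀] {B : Ω₀ → Matrix (Fin n) (Fin n) ℝ} (hBmeas : AEMeasurable B μ₀)
    (hBpsd : ∀ᵐ ω ∂μ₀, (B ω).PosSemidef) (hBexp : HasMatrixExpectation B μ₀ 1)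
    (hMSR : MSR B μ₀ c η) : IsRegularLaw c η (μ₀.map B) where
  isProbabilityMeasure := Measure.isProbabilityMeasure_map hBmeas
  nonneg := (ae_map_iff hBmeas (measurableSet_setOf_nonneg n)).mpr
    (hBpsd.mono fun _ h => Matrix.nonneg_iff_posSemidef.mpr h)
  mean i j := by
    have hij : Measurable fun b : Matrix (Fin n) (Fin n) ℝ => b i j :=
      (measurable_pi_apply j).comp (measurable_pi_apply i)
    exact ⟨(integrable_map_measure hij.aestronglyMeasurable hBmeas).mpr (hBexp i j).1,
      (integral_map hBmeas hij.aestronglyMeasurable).trans (hBexp i j).2⟩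
  msr P hP t ht hrank := by
    have hs : MeasurableSet {b : Matrix (Fin n) (Fin n) ℝ | t ≤ ‖P * b * P‖} :=
      measurableSet_le measurable_const (continuous_norm_mul_mul P).measurable
    rw [measureReal_def, Measure.map_apply_of_aemeasurable hBmeas hs]
    exact hMSR P hP t ht hrank

end Assembly

theorem mainTheorem1
    {Ω₀ : Type*} [MeasurableSpace Ω₀] (μ₀ : Measure Ω₀) [IsProbabilityMeasure μ₀]
    {n : ℕ} (B : Ω₀ → Matrix (Fin n) (Fin n) ℝ) (hBmeas : AEMeasurable B μ₀)
    (hBpsd : ∀ᵐ ω ∂μ₀, (B ω).PosSemidef)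
    (hBexp : HasMatrixExpectation B μ₀ 1)
    (c η : ℝ) (hc : 0 < c) (hη : 0 < η) (hMSR : MSR B μ₀ c η)
    (ε : ℝ) (hε0 : 0 < ε) (hε1 : ε < 1)
    (N : ℕ) (hN : covConst c η * (n : ℝ) / ε ^ (2 + 2 / η) ≤ (N : ℝ))
    {Ω : Type*} [MeasurableSpace Ω] (μ : Measure Ω) [IsProbabilityMeasure μ]
    (Bs : Fin N → Ω → Matrix (Fin n) (Fin n) ℝ)
    (hident : ∀ i, IdentDistrib (Bs i) B μ μ₀) (hindep : iIndepFun Bs μ) :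
    Integrable (fun ω => ‖((1 / (N : ℝ)) • (∑ i, Bs i ω)) - (1 : Matrix (Fin n) (Fin n) ℝ)‖) μ ∧
      ∫ ω, ‖((1 / (N : ℝ)) • (∑ i, Bs i ω)) - (1 : Matrix (Fin n) (Fin n) ℝ)‖ ∂μ ≤ ε := by
  have hlaw : ∀ i, μ.map (Bs i) = μ₀.map B := fun i => (hident i).map_eq
  have hm : ∀ i, AEMeasurable (Bs i) μ := fun i => (hident i).aemeasurable_fst
  have hν := isRegularLaw_map hBmeas hBpsd hBexp hMSR
  have hint : Integrable
      (fun ω => ‖((1 / (N : ℝ)) • (∑ i, Bs i ω)) - (1 : Matrix (Fin n) (Fin n) ℝ)‖) μ := by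
    have h1 := hν.integrable_norm_sum hm hlaw Finset.univ
    have h2 : AEMeasurable (fun ω => ∑ i, Bs i ω) μ :=
      Finset.aemeasurable_fun_sum Finset.univ fun i _ => hm i
    have h3 : Continuous fun S : Matrix (Fin n) (Fin n) ℝ => ‖(1 / (N : ℝ)) • S - 1‖ := by
      fun_prop
    refine ((h1.const_mul (1 / (N : ℝ))).add
      (integrable_const ‖(1 : Matrix (Fin n) (Fin n) ℝ)‖)).mono'
      (h3.measurable.comp_aemeasurable h2).aestronglyMeasurable
      (Filter.Eventually.of_forall fun ω => ?_)
    rw [norm_norm]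
    refine (norm_sub_le _ _).trans ?_
    rw [norm_smul, Real.norm_of_nonneg (by positivity), ← Finset.sum_apply]
    rfl
  refine ⟨hint, ?_⟩
  -- The barrier argument needs a nonempty index set; in dimension `0` every norm vanishes.
  rcases isEmpty_or_nonempty (Fin n) with hn | hn
  · have h0 : ∀ A : Matrix (Fin n) (Fin n) ℝ, ‖A‖ = 0 := fun A => by
      rw [Subsingleton.elim A 0, norm_zero]
    simp only [h0, integral_zero]
    exact hε0.le
  have hD : 0 < 1 + 1 / η := by positivity
  have hε2 : 0 < ε ^ (2 / η) := Real.rpow_pos_of_pos hε0 _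
  -- The number with `c r^(-η) (1 + 1/η)² = ε²/256`; the truncation level is the maximum of `r` and
  -- the required lower bound `2c`.
  set r := (256 * c * (1 + 1 / η) ^ 2 / ε ^ 2) ^ (1 / η) with hr
  have hr0 : 0 < r := by positivity
  have ha0 : 0 < max (2 * c) r := lt_max_of_lt_right hr0
  have hεr : r * ε ^ (2 / η) = (256 * c * (1 + 1 / η) ^ 2) ^ (1 / η) := by
    have e : (ε ^ 2) ^ (1 / η) = ε ^ (2 / η) := by
      rw [← Real.rpow_natCast, ← Real.rpow_mul hε0.le, Nat.cast_ofNat, mul_one_div]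
    rw [hr, Real.div_rpow (by positivity) (by positivity), e, div_mul_cancel₀ _ hε2.ne']
  refine hν.integral_norm_le hc hη hε0 hε1 (le_max_left (2 * c) r) ?_ ?_ hm hlaw hindep
  · have h1 : 256 * c * (1 + 1 / η) ^ 2 / ε ^ 2 ≤ max (2 * c) r ^ η := by
      calc 256 * c * (1 + 1 / η) ^ 2 / ε ^ 2 = r ^ η := by
            rw [hr, ← Real.rpow_mul (by positivity), one_div_mul_cancel hη.ne', Real.rpow_one]
        _ ≤ _ := Real.rpow_le_rpow hr0.le (le_max_right _ _) hη.le
    have h2 : 0 < max (2 * c) r ^ η := Real.rpow_pos_of_pos ha0 _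
    rw [div_le_iff₀ (by positivity)] at h1
    rw [Real.rpow_neg ha0.le, ← div_eq_mul_inv, div_mul_eq_mul_div, div_le_iff₀ h2]
    linarith
  · have h1 : 256 * (max (2 * c) r * (1 + 1 / η)) * ε ^ (2 / η) ≤ covConst c η := by
      rcases max_cases (2 * c) r with ⟨h, -⟩ | ⟨h, -⟩
      · rw [h]
        have h2 : ε ^ (2 / η) ≤ 1 := Real.rpow_le_one hε0.le hε1.le (by positivity)
        calc 256 * (2 * c * (1 + 1 / η)) * ε ^ (2 / η) ≤ 256 * (2 * c * (1 + 1 / η)) * 1 := by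
              gcongr
          _ = 512 * (1 + 1 / η) * c := by ring
          _ ≤ _ := mul_le_covConst hc hη (hν.div_four_le hc hη)
      · rw [h]
        calc 256 * (r * (1 + 1 / η)) * ε ^ (2 / η)
            = 256 * (1 + 1 / η) * (r * ε ^ (2 / η)) := by ring
          _ ≤ _ := by rw [hεr]; exact mul_le_covConst_of_rpow hc hη
    rw [Real.rpow_add hε0, div_le_iff₀ (by positivity), Real.rpow_ofNat] at hN
    have h2 : 256 * n * (max (2 * c) r * (1 + 1 / η)) * ε ^ (2 / η) ≤
        N * ε ^ 2 * ε ^ (2 / η) := by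
      calc _ = 256 * (max (2 * c) r * (1 + 1 / η)) * ε ^ (2 / η) * n := by ring
        _ ≤ covConst c η * n := by gcongr
        _ ≤ _ := by linarith
    exact le_of_mul_le_mul_right h2 hε2
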